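/- Let $G$ be the free group on generators $u_1,\dots,u_n$, $n\ge 2$. For $s\in G$ written as a reduced word, let $|s|_i$ be the number of occurrences of $u_i$ or $u_i^{-1}$ in $s$, and let $\gamma(s)$ be the number of occurrences of $u_k^{-1}u_j$ with $k\ne j$. A *state* of $G$ is a positive definite function $\varphi:G\to\mathbb C$ with $\varphi(1)=1$; extend it linearly to the group algebra $\mathbb CG$. It is *reduced* if it is bounded on $\mathbb CG$ with respect to the operator norm of the left regular representation on $\ell^2(G)$. For $X\in\mathbb CG$ and $\lambda\in\mathbb C$, it is a *$\lambda$-eigenstate* for $X$ if $\varphi((X^*-\bar\lambda)(X-\lambda))=0$. (a) Let $c_1,\dots,c_n\ge 0$, not all zero, and $\lambda=(\sum_i c_i^2)^{1/2}$. Then the function $$\varphi(s)=\begin{cases}\prod_i (c_i/\lambda)^{|s|_i} & \text{if }\gamma(s)=0,\\ 0 & \text{otherwise}\end{cases}\qquad(0^0=1)$$ is a reduced $\lambda$-eigenstate for $\sum_i c_iu_i$, and it is the only one. (b) More generally, let $c_1,\dots,c_n\in\mathbb C$, not all zero, and $\lambda\in\mathbb C$ with $|\lambda|^2=\sum_i|c_i|^2$.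 Then $\sum_i c_iu_i$ has exactly one reduced $\lambda$-eigenstate: the function that is $0$ at every $s$ with $\gamma(s)\neq 0$, and that at an $s$ with $\gamma(s)=0$ is the product over the letters of the reduced word $s$ of the factors $\overline{c_i/\lambda}$ for each letter $u_i$ and $c_i/\lambda$ for each letter $u_i^{-1}$. (c) Let $c_1,\dots,c_n\in\mathbb C$, let $j$ be an index with $|c_j|^2>\sum_{i\ne j}|c_i|^2$, and let $\lambda\in\mathbb C$ satisfy $|\lambda|^2=|c_j|^2-\sum_{i\ne j}|c_i|^2$ (so that $\lambda$ lies on the inner boundary of the spectral annulus of $\sum_i c_iu_i$). Then $\sum_i c_iu_i$ has exactly one reduced $\lambda$-eigenstate. -/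

import Mathlib

open scoped BigOperators ComplexConjugate ComplexOrder

noncomputable section

namespace ReducedEigenstate

section Group

variable {G : Type*} [Group G]

/-- The Hilbert space `ℓ²(G)` of square summable complex functions on `G`. -/
abbrev EllTwo (G : Type*) : Type _ := lp (fun _ : G => ℂ) 2

/-- Left translates of square summable functions are square summable. -/
theorem memlp_leftTranslate (g : G) (f : EllTwo G) :
    Memℓp (fun h : G => f (g⁻¹ * h)) 2 := by
  have hp : 0 < (2 : ENNReal).toReal := by norm_num
  have hf := (lp.memℓp f).summable hp
  exact memℓp_gen ((Equiv.mulLeft g⁻¹).summable_iff.mpr hf)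

/-- Left translation by `g` on `ℓ²(G)`: `(leftTranslate g f)(h) = f(g⁻¹h)`, a linear isometry. -/
def leftTranslate (g : G) : EllTwo G →ₗᵢ[ℂ] EllTwo G where
  toFun f := ⟨fun h => f (g⁻¹ * h), memlp_leftTranslate g f⟩
  map_add' _ _ := rfl
  map_smul' _ _ := rfl
  norm_map' f := by
    have hp : 0 < (2 : ENNReal).toReal := by norm_num
    rw [lp.norm_eq_tsum_rpow hp, lp.norm_eq_tsum_rpow hp]
    congr 1
    exact (Equiv.mulLeft g⁻¹).tsum_eq (fun h => ‖f h‖ ^ (2 : ENNReal).toReal)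

theorem leftTranslate_apply (g : G) (f : EllTwo G) (h : G) : leftTranslate g f h = f (g⁻¹ * h) := rfl

variable (G) in
/-- The left regular representation of the group `G` on `ℓ²(G)`. -/
def leftRegular : G →* (EllTwo G →L[ℂ] EllTwo G) where
  toFun g := (leftTranslate g).toContinuousLinearMap
  map_one' := by
    ext f h
    change f ((1 : G)⁻¹ * h) = f h
    simp
  map_mul' a b := by
    ext f h
    change f ((a * b)⁻¹ * h) = f (b⁻¹ * (a⁻¹ * h))
    simp [mul_assoc]

variable (G) in
/-- The left regular representation of the complex group algebra `ℂG` on `ℓ²(G)`. -/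
def regularRep : MonoidAlgebra ℂ G →ₐ[ℂ] (EllTwo G →L[ℂ] EllTwo G) :=
  MonoidAlgebra.lift ℂ (EllTwo G →L[ℂ] EllTwo G) G (leftRegular G)

/-- The involution of the group algebra: `(∑ a_g g)* = ∑ conj(a_g) g⁻¹`. -/
def involution (a : MonoidAlgebra ℂ G) : MonoidAlgebra ℂ G :=
  a.coeff.sum fun g z => MonoidAlgebra.single g⁻¹ (conj z)

/-- The linear extension to `ℂG` of a function `φ` on `G`: `∑ a_g g ↦ ∑ a_g φ(g)`. -/
def extend (φ : G → ℂ) (a : MonoidAlgebra ℂ G) : ℂ :=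
  a.coeff.sum fun g z => z * φ g

/-- A state of `G`: a unital positive definite function on `G`. (In the order of `ℂ`, `0 ≤ z` says
that `z` is real and nonnegative.) -/
structure IsState (φ : G → ℂ) : Prop where
  unital : φ 1 = 1
  posDef : ∀ (F : Finset G) (a : G → ℂ),
    0 ≤ ∑ s ∈ F, ∑ t ∈ F, conj (a s) * a t * φ (s⁻¹ * t)

/-- `φ`, extended linearly to `ℂG`, is bounded with respect to the operator norm on `ℂG` in the
left regular representation. -/
def IsReduced (φ : G → ℂ) : Prop :=
  ∃ C : ℝ, ∀ a : MonoidAlgebra ℂ G, ‖extend φ a‖ ≤ C * ‖regularRep G a‖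

/-- `φ((X* - conj l)(X - l)) = 0`. -/
def IsEigen (X : MonoidAlgebra ℂ G) (l : ℂ) (φ : G → ℂ) : Prop :=
  extend φ ((involution X - algebraMap ℂ (MonoidAlgebra ℂ G) (conj l)) *
    (X - algebraMap ℂ (MonoidAlgebra ℂ G) l)) = 0

/-- A reduced `l`-eigenstate for the element `X` of the group algebra. -/
structure IsReducedEigenstate (X : MonoidAlgebra ℂ G) (l : ℂ) (φ : G → ℂ) : Prop where
  state : IsState φ
  reduced : IsReduced φ
  eigen : IsEigen X l φ

end Group

section Free

variable {n : ℕ}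

/-- The element `∑ c_i u_i` of the group algebra of the free group on `u_1, …, u_n`. -/
def genSum (c : Fin n → ℂ) : MonoidAlgebra ℂ (FreeGroup (Fin n)) :=
  ∑ i, MonoidAlgebra.single (FreeGroup.of i) (c i)

/-- `|s|_i`: the number of occurrences of `u_i` or `u_i⁻¹` in the reduced word of `s`. (A letter is
a pair `(i, b)`, which stands for `u_i` if `b = true` and for `u_i⁻¹` if `b = false`.) -/
def letterCount (i : Fin n) (s : FreeGroup (Fin n)) : ℕ :=
  s.toWord.countP fun p => p.1 = i

/-- `γ(s)`: the number of occurrences of `u_k⁻¹ u_j`, `k ≠ j`, in the reduced word of `s`. -/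
def gamma (s : FreeGroup (Fin n)) : ℕ :=
  (s.toWord.zip s.toWord.tail).countP fun q =>
    q.1.2 = false ∧ q.2.2 = true ∧ q.1.1 ≠ q.2.1

/-- The function that vanishes where `γ(s) ≠ 0`, and where `γ(s) = 0` is the product over the
letters of the reduced word of `s` of the weights `w_i` (for `u_i`) and `conj w_i`
(for `u_i⁻¹`). -/
def weightState (w : Fin n → ℂ) (s : FreeGroup (Fin n)) : ℂ :=
  if gamma s = 0 then
    (s.toWord.map fun p => if p.2 = true then w p.1 else conj (w p.1)).prod
  else 0

end Free

end ReducedEigenstate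

end

/-!
Write `X = ∑ c_i u_i`, and let a reduced state `φ` be an eigenstate of `X` at `l`. The theorem rests
on the outer boundary `|l|² = ∑ |c_i|²`, where after division by `l` the eigenvalue is `1` and
`∑ |c_i|² = 1`.

*Passage to `B(ℓ²(G))`.* The inequality `|φ(a)|² ≤ φ(a* a)` improves any bound `C` in the definition
of a reduced state to `√C`, hence to `1` (`norm_extend_le`). So `φ` extends, by Hahn–Banach, to a
functional of norm one on `B(ℓ²(G))`, which is positive because it is unital
(`nonneg_of_norm_le_one`). Its GNS representation contains a unitary representation `U` of `G`, a
vector `ξ` with `φ(s) = ⟨ξ, U_s ξ⟩` and `∑ c_i U_i ξ = ξ`, and also projections `E(S)` for all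
`S ⊆ G`, the images of the indicator functions, with `U_g E(S) U_g⁻¹ = E(gS)`.

*Uniqueness.* Let `N` be the set of the words that start with the inverse of a generator, and
`η = E(N) ξ`. The eigenvalue equation makes `η` a combination with coefficients `c_i` of vectors
whose norms have square sum at most `‖η‖²`. This is the equality case of the Cauchy–Schwarz
inequality, and it determines `‖E(S) ξ‖` for the set `S` of the words that start with `u_i⁻¹`. The
rest of the equation, a sum of vectors with orthogonal supports, then gives
`(1 - ∑ |c_i|⁴) ‖η‖² = 0`, so that `η = 0` or a single `c_i` is nonzero
(`repE_startsNeg_eq_zero_or`). In both cases `U_s ξ` lives on the words starting with `u_j` or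
`u_j⁻¹`, for every `s` whose reduced word starts with `u_j` (`repE_startsIndex_repU_mk`). These
supports are disjoint for different `j`, so `φ` vanishes where `γ ≠ 0`, and the eigenvalue equation
gives the value of `φ` at the other words letter by letter (`inner_repU_eq_weightState`).

*Existence.* The vectors `X^m δ_1` are orthonormal, as they are supported on the positive words of
length `m`, so their normalized partial sums are approximate eigenvectors. An ultrafilter limit of
their vector states is a reduced eigenstate (`exists_isReducedEigenstate`), and by uniqueness it is
the function in the statement.

*Inner boundary.* If `|l|² = |c_j|² - ∑_{i ≠ j} |c_i|²`, then multiplication by `u_j⁻¹` turns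
`X ξ = l ξ` into `(l u_j⁻¹ - ∑_{i ≠ j} c_i u_j⁻¹ u_i) ξ = c_j ξ`. Here `u_j⁻¹` and the `u_j⁻¹ u_i`
are again free generators, and `c_j` lies on the outer boundary for the new coefficients. The
automorphism of the free group that exchanges the two systems of generators preserves the norm of
the regular representation, and so the reduced states.
-/

noncomputable section

namespace ReducedEigenstate

/-! ### States of the group algebra -/

section GroupAlgebra

variable {G : Type*} [Group G]

/-- `extend φ` as a linear functional on the group algebra. -/
def extendLinear {G : Type*} (φ : G → ℂ) : MonoidAlgebra ℂ G →ₗ[ℂ] ℂ where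
  toFun := extend φ
  map_add' a b := by
    classical
    simp only [extend, MonoidAlgebra.coeff_add]
    exact Finsupp.sum_add_index' (by simp) (by intros; ring)
  map_smul' z a := by
    simp only [extend, MonoidAlgebra.coeff_smul, RingHom.id_apply, smul_eq_mul]
    rw [Finsupp.sum_smul_index' (by simp), Finsupp.mul_sum]
    simp [mul_assoc]

theorem extendLinear_apply {G : Type*} (φ : G → ℂ) (a : MonoidAlgebra ℂ G) :
    extendLinear φ a = extend φ a := rfl

@[simp]
theorem extendLinear_single {G : Type*} (φ : G → ℂ) (g : G) (z : ℂ) :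
    extendLinear φ (MonoidAlgebra.single g z) = z * φ g := by
  simp [extendLinear, extend]

/-- The involution of the group algebra as an additive map. -/
def involutionHom : MonoidAlgebra ℂ G →+ MonoidAlgebra ℂ G where
  toFun := involution
  map_zero' := by simp [involution]
  map_add' a b := by
    classical
    simp only [involution, MonoidAlgebra.coeff_add]
    exact Finsupp.sum_add_index' (by simp) (by intros; simp [MonoidAlgebra.single_add])

theorem involutionHom_apply (a : MonoidAlgebra ℂ G) : involutionHom a = involution a := rfl

@[simp]
theorem involutionHom_single (g : G) (z : ℂ) :
    involutionHom (MonoidAlgebra.single g z) = MonoidAlgebra.single g⁻¹ (conj z) := by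
  rw [involutionHom_apply, involution, MonoidAlgebra.coeff_single,
    Finsupp.sum_single_index (by simp)]

/-- Additive statements about the group algebra need only be checked on the elements `z g`. -/
theorem groupAlgebra_induction {p : MonoidAlgebra ℂ G → Prop} (a : MonoidAlgebra ℂ G)
    (h0 : p 0) (h1 : ∀ g z, p (MonoidAlgebra.single g z)) (h2 : ∀ a b, p a → p b → p (a + b)) :
    p a := by
  obtain ⟨f⟩ := a
  induction f using Finsupp.induction_linear with
  | zero => exact h0
  | add f g hf hg => exact h2 _ _ hf hg
  | single g z => exact h1 g z

theorem algebraMap_eq_single (z : ℂ) :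
    algebraMap ℂ (MonoidAlgebra ℂ G) z = MonoidAlgebra.single 1 z := by
  simp [MonoidAlgebra.coe_algebraMap]

@[simp]
theorem involutionHom_algebraMap (z : ℂ) :
    involutionHom (algebraMap ℂ (MonoidAlgebra ℂ G) z) =
      algebraMap ℂ (MonoidAlgebra ℂ G) (conj z) := by
  simp [algebraMap_eq_single]

@[simp]
theorem regularRep_single (g : G) (z : ℂ) :
    regularRep G (MonoidAlgebra.single g z) = z • leftRegular G g := by
  simp [regularRep, MonoidAlgebra.lift_single]

theorem leftRegular_apply (g : G) (f : EllTwo G) (h : G) : leftRegular G g f h = f (g⁻¹ * h) := rfl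

theorem star_leftRegular (g : G) : star (leftRegular G g) = leftRegular G g⁻¹ := by
  rw [ContinuousLinearMap.star_eq_adjoint, eq_comm, ContinuousLinearMap.eq_adjoint_iff]
  intro x y
  rw [lp.inner_eq_tsum, lp.inner_eq_tsum, ← (Equiv.mulLeft g).symm.tsum_eq]
  refine tsum_congr fun h => ?_
  simp [leftRegular_apply]

theorem regularRep_involution (a : MonoidAlgebra ℂ G) :
    regularRep G (involutionHom a) = star (regularRep G a) := by
  induction a using groupAlgebra_induction with
  | h0 => simp
  | h1 g z => simp [star_leftRegular]
  | h2 a b ha hb => simp [ha, hb]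

theorem extend_involution_mul (φ : G → ℂ) (a b : MonoidAlgebra ℂ G) :
    extend φ (involution a * b) =
      a.coeff.sum fun s z => b.coeff.sum fun t w => conj z * w * φ (s⁻¹ * t) := by
  rw [← involutionHom_apply, ← extendLinear_apply]
  induction a using groupAlgebra_induction with
  | h0 => simp
  | h1 g z =>
    rw [MonoidAlgebra.coeff_single, Finsupp.sum_single_index (by simp), involutionHom_single]
    induction b using groupAlgebra_induction with
    | h0 => simp
    | h1 h w => simp [MonoidAlgebra.single_mul_single]
    | h2 a b ha hb =>
      classical
      rw [mul_add, map_add, ha, hb, MonoidAlgebra.coeff_add,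
        Finsupp.sum_add_index' (by simp) (by intros; ring)]
  | h2 a b ha hb =>
    classical
    rw [map_add, add_mul, map_add, ha, hb, MonoidAlgebra.coeff_add,
      Finsupp.sum_add_index' (by simp)]
    intro g z w
    simp [add_mul, Finsupp.sum_add]

/-- Complex conjugation implements inversion on a positive definite function. -/
theorem IsState.map_inv {φ : G → ℂ} (hφ : IsState φ) (s : G) : φ s⁻¹ = conj (φ s) := by
  classical
  by_cases hs : s = 1
  · simp [hs, hφ.unital]
  have key : ∀ z : ℂ, 0 ≤ 1 + z * φ s + (conj z * φ s⁻¹ + conj z * z) := by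
    intro z
    have h := hφ.posDef {1, s} (fun g => if g = s then z else 1)
    simpa [Finset.sum_pair (Ne.symm hs), hφ.unital, Ne.symm hs] using h
  have h1 := (Complex.nonneg_iff.1 (key 1)).2
  have h2 := (Complex.nonneg_iff.1 (key Complex.I)).2
  simp at h1 h2
  apply Complex.ext <;> simp <;> linarith

theorem IsState.extend_involution {φ : G → ℂ} (hφ : IsState φ) (a : MonoidAlgebra ℂ G) :
    extendLinear φ (involutionHom a) = conj (extendLinear φ a) := by
  induction a using groupAlgebra_induction with
  | h0 => simp
  | h1 g z => simp [hφ.map_inv]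
  | h2 a b ha hb => simp [ha, hb]

theorem IsState.extend_star_mul_self_nonneg {φ : G → ℂ} (hφ : IsState φ)
    (a : MonoidAlgebra ℂ G) : 0 ≤ extendLinear φ (involutionHom a * a) := by
  rw [extendLinear_apply, involutionHom_apply, extend_involution_mul]
  exact hφ.posDef a.coeff.support a.coeff

theorem IsState.norm_extend_sq_le {φ : G → ℂ} (hφ : IsState φ) (a : MonoidAlgebra ℂ G) :
    ‖extendLinear φ a‖ ^ 2 ≤ ‖extendLinear φ (involutionHom a * a)‖ := by
  have h := hφ.extend_star_mul_self_nonneg (a - algebraMap ℂ _ (extendLinear φ a))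
  set z := extendLinear φ a with hz
  have h1 : extendLinear φ (algebraMap ℂ _ (conj z * z)) = conj z * z := by
    simp [algebraMap_eq_single, hφ.unital]
  have h2 : involutionHom (a - algebraMap ℂ _ z) * (a - algebraMap ℂ _ z) =
      involutionHom a * a - z • involutionHom a - conj z • a + algebraMap ℂ _ (conj z * z) := by
    rw [map_sub, involutionHom_algebraMap]
    simp only [Algebra.algebraMap_eq_smul_one]
    simp only [sub_mul, mul_sub, smul_mul_assoc, mul_smul_comm, mul_one, one_mul, smul_sub,
      smul_smul, mul_comm z]
    abel
  rw [h2, map_add, h1, map_sub, map_sub, map_smul, map_smul, hφ.extend_involution, ← hz] at h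
  have h3 := (Complex.nonneg_iff.1 h).1
  have h4 : (conj z * z).re = ‖z‖ ^ 2 := by
    rw [Complex.conj_mul']; norm_cast
  have h5 := Complex.re_le_norm (extendLinear φ (involutionHom a * a))
  simp only [smul_eq_mul, Complex.sub_re, Complex.add_re, mul_comm z, h4] at h3
  linarith

theorem norm_star_mul_self_clm {H : Type*} [NormedAddCommGroup H] [InnerProductSpace ℂ H]
    [CompleteSpace H] (T : H →L[ℂ] H) : ‖star T * T‖ = ‖T‖ * ‖T‖ :=
  CStarRing.norm_star_mul_self

/-- A reduced state is a contraction for the operator norm of the regular representation: the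
inequality `|φ(a)|² ≤ φ(a* a)` replaces a bound `C` by `√C`. -/
theorem norm_extend_le {φ : G → ℂ} (hφ : IsState φ) (hr : IsReduced φ)
    (a : MonoidAlgebra ℂ G) : ‖extendLinear φ a‖ ≤ ‖regularRep G a‖ := by
  obtain ⟨C, hC⟩ := hr
  have hC' : ∀ a : MonoidAlgebra ℂ G, ‖extendLinear φ a‖ ≤ max C 1 * ‖regularRep G a‖ := fun a =>
    (hC a).trans (by gcongr; exact le_max_left _ _)
  have h1 : (1 : ℝ) ≤ max C 1 := le_max_right _ _
  generalize max C 1 = D at hC' h1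
  have key : ∀ k : ℕ, ∀ a : MonoidAlgebra ℂ G,
      ‖extendLinear φ a‖ ^ 2 ^ k ≤ D * ‖regularRep G a‖ ^ 2 ^ k := by
    intro k
    induction k with
    | zero => simpa using hC'
    | succ k ih =>
      intro a
      have h := ih (involutionHom a * a)
      have hstar : ‖star (regularRep G a) * regularRep G a‖ =
          ‖regularRep G a‖ * ‖regularRep G a‖ := norm_star_mul_self_clm _
      rw [map_mul (regularRep G), regularRep_involution, hstar] at h
      calc ‖extendLinear φ a‖ ^ 2 ^ (k + 1) = (‖extendLinear φ a‖ ^ 2) ^ 2 ^ k := by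
            rw [← pow_mul]; congr 1; ring
        _ ≤ ‖extendLinear φ (involutionHom a * a)‖ ^ 2 ^ k := by
            gcongr; exact hφ.norm_extend_sq_le a
        _ ≤ _ := h
        _ = D * ‖regularRep G a‖ ^ 2 ^ (k + 1) := by
            rw [← sq, ← pow_mul]; congr 2; ring
  by_contra! hlt
  rcases (norm_nonneg (regularRep G a)).eq_or_lt with h0 | h0
  · have := hC' a
    rw [← h0] at this hlt
    simp at this
    simp [this] at hlt
  -- the ratio `‖φ(a)‖ / ‖a‖ > 1` would have unbounded powers
  have hq : 1 < ‖extendLinear φ a‖ / ‖regularRep G a‖ := (one_lt_div h0).2 hlt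
  obtain ⟨k, hk⟩ := pow_unbounded_of_one_lt D hq
  have h2 := key k a
  have h3 : (‖extendLinear φ a‖ / ‖regularRep G a‖) ^ k ≤
      (‖extendLinear φ a‖ / ‖regularRep G a‖) ^ 2 ^ k :=
    pow_le_pow_right₀ hq.le Nat.lt_two_pow_self.le
  rw [div_pow _ _ (2 ^ k)] at h3
  have h4 := (div_le_iff₀ (pow_pos h0 (2 ^ k))).2 h2
  linarith

end GroupAlgebra

/-! ### Positive extensions and the GNS representation -/

/-- A unital functional of norm at most one on a C⋆-algebra is positive. -/
theorem nonneg_of_norm_le_one {A : Type*} [CStarAlgebra A] [PartialOrder A] [StarOrderedRing A]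
    (f : A →L[ℂ] ℂ) (hf : ‖f‖ ≤ 1) (h1 : f 1 = 1) (a : A) (ha : 0 ≤ a) : 0 ≤ f a := by
  have hle : ∀ x : A, ‖f x‖ ≤ ‖x‖ := fun x => (f.le_opNorm x).trans (by
    simpa using mul_le_mul_of_nonneg_right hf (norm_nonneg x))
  have hmap : ∀ z : ℂ, f (algebraMap ℂ A z) = z := by
    intro z; simp [Algebra.algebraMap_eq_smul_one, h1]
  have hsa : star a = a := (IsSelfAdjoint.of_nonneg ha)
  rw [Complex.nonneg_iff]
  constructor
  · -- `‖ ‖a‖ - a ‖ ≤ ‖a‖`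
    have hb : ‖algebraMap ℂ A (‖a‖ : ℂ) - a‖ ≤ ‖a‖ := by
      have hle1 : a ≤ algebraMap ℝ A ‖a‖ := IsSelfAdjoint.le_algebraMap_norm_self hsa
      have he : algebraMap ℂ A (‖a‖ : ℂ) = algebraMap ℝ A ‖a‖ :=
        (IsScalarTower.algebraMap_apply ℝ ℂ A ‖a‖).symm
      rw [he]
      rcases subsingleton_or_nontrivial A with hA | hA
      · simp [Subsingleton.elim _ (0 : A)]
      refine (CStarAlgebra.norm_le_norm_of_nonneg_of_le (sub_nonneg.2 hle1)
        (sub_le_self _ ha)).trans ?_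
      rw [norm_algebraMap', Real.norm_of_nonneg (norm_nonneg a)]
    have h := (Complex.re_le_norm _).trans ((hle _).trans hb)
    rw [map_sub, hmap, Complex.sub_re, Complex.ofReal_re] at h
    linarith
  · -- `|f(a) + i t|² ≤ ‖a + i t‖² ≤ ‖a‖² + t²` for all real `t`
    have key : ∀ t : ℝ, ((f a).im + t) ^ 2 ≤ ‖a‖ ^ 2 + t ^ 2 := by
      intro t
      set b := a + algebraMap ℂ A (t * Complex.I) with hb
      have h2 : ‖b‖ ^ 2 ≤ ‖a‖ ^ 2 + t ^ 2 := by
        rw [sq, ← CStarRing.norm_star_mul_self]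
        have : star b * b = a * a + algebraMap ℂ A (t ^ 2) := by
          rw [hb, star_add, hsa, ← algebraMap_star_comm]
          simp only [Algebra.algebraMap_eq_smul_one, add_mul, mul_add, smul_mul_assoc,
            mul_smul_comm, one_mul, mul_one, smul_add, smul_smul]
          simp only [RCLike.star_def, map_mul, Complex.conj_ofReal, Complex.conj_I]
          rw [show (t * Complex.I : ℂ) * (t * -Complex.I) = t ^ 2 by
            linear_combination (-(t : ℂ) ^ 2) * Complex.I_sq]
          simp only [mul_neg, neg_smul]
          abel
        rw [this]
        rcases subsingleton_or_nontrivial A with hA | hA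
        · simp only [Subsingleton.elim _ (0 : A), norm_zero]; positivity
        refine (norm_add_le _ _).trans (add_le_add ?_ ?_)
        · rw [sq]; exact norm_mul_le _ _
        · rw [norm_algebraMap']; simp
      have h3 : ‖f b‖ ^ 2 ≤ ‖b‖ ^ 2 := by gcongr; exact hle b
      have h4 : (f b).im = (f a).im + t := by rw [hb, map_add, hmap]; simp
      have h5 : (f b).im ^ 2 ≤ ‖f b‖ ^ 2 := by
        rw [← sq_abs]; gcongr; exact Complex.abs_im_le_norm _
      rw [h4] at h5
      linarith
    by_contra hne
    have h := key ((‖a‖ ^ 2 + 1) / (2 * (f a).im))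
    have hne' : (f a).im ≠ 0 := fun h => hne h.symm
    have : 2 * (f a).im * ((‖a‖ ^ 2 + 1) / (2 * (f a).im)) = ‖a‖ ^ 2 + 1 := by
      field_simp
    nlinarith [sq_nonneg (f a).im]

theorem exists_positive_extension {G : Type*} [Group G] {φ : G → ℂ} (hφ : IsState φ)
    (hr : IsReduced φ) :
    ∃ Φ : (EllTwo G →L[ℂ] EllTwo G) →ₚ[ℂ] ℂ, ∀ a, Φ (regularRep G a) = extendLinear φ a := by
  let R : MonoidAlgebra ℂ G →ₗ[ℂ] (EllTwo G →L[ℂ] EllTwo G) := (regularRep G).toLinearMap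
  have hker : LinearMap.ker R ≤ LinearMap.ker (extendLinear φ) := by
    intro a ha
    have h := norm_extend_le hφ hr a
    have h0 : regularRep G a = 0 := ha
    rw [h0, norm_zero, norm_le_zero_iff] at h
    exact h
  let f : LinearMap.range R →ₗ[ℂ] ℂ :=
    (Submodule.liftQ _ (extendLinear φ) hker).comp R.quotKerEquivRange.symm.toLinearMap
  have hf : ∀ a (h : R a ∈ LinearMap.range R), f ⟨R a, h⟩ = extendLinear φ a := by
    intro a h
    have : R.quotKerEquivRange.symm ⟨R a, h⟩ = Submodule.Quotient.mk a := by
      rw [LinearEquiv.symm_apply_eq]; rfl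
    simp [f, this]
  have hbound : ∀ x, ‖f x‖ ≤ 1 * ‖x‖ := by
    rintro ⟨_, a, rfl⟩
    exact ((congrArg norm (hf a (LinearMap.mem_range_self R a))).trans_le
      (norm_extend_le hφ hr a)).trans_eq (one_mul _).symm
  obtain ⟨g, hg, hgn⟩ := exists_extension_norm_eq (LinearMap.range R) (f.mkContinuous 1 hbound)
  have hg' : ∀ a, g (regularRep G a) = extendLinear φ a := fun a =>
    (hg ⟨R a, a, rfl⟩).trans (hf a _)
  have hn : ‖g‖ ≤ 1 := hgn.trans_le (LinearMap.mkContinuous_norm_le _ zero_le_one _)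
  have h1 : g 1 = 1 := by
    rw [← map_one (regularRep G), hg', MonoidAlgebra.one_def]
    simp [hφ.unital]
  exact ⟨PositiveLinearMap.mk₀ g.toLinearMap (nonneg_of_norm_le_one g hn h1), hg'⟩

/-- The vector state of the GNS representation at the class of `1` is the given functional. -/
theorem inner_gns {A : Type*} [CStarAlgebra A] [PartialOrder A] [StarOrderedRing A]
    (Φ : A →ₚ[ℂ] ℂ) (S T : A) :
    inner ℂ (Φ.gnsStarAlgHom S (Φ.toPreGNS 1 : Φ.GNS)) (Φ.gnsStarAlgHom T (Φ.toPreGNS 1 : Φ.GNS)) =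
      Φ (star S * T) := by
  simp [PositiveLinearMap.gnsNonUnitalStarAlgHom_apply_coe, PositiveLinearMap.preGNS_inner_def]

/-- A reduced state is a vector state of a representation of `G` that extends to all bounded
operators on `ℓ²(G)`. -/
theorem exists_representation.{u} {G : Type u} [Group G] {φ : G → ℂ} (hφ : IsState φ)
    (hr : IsReduced φ) :
    ∃ (K : Type u) (_ : NormedAddCommGroup K) (_ : InnerProductSpace ℂ K) (_ : CompleteSpace K)
      (ρ : (EllTwo G →L[ℂ] EllTwo G) →⋆ₐ[ℂ] (K →L[ℂ] K)) (ξ : K),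
      ∀ a, inner ℂ ξ (ρ (regularRep G a) ξ) = extendLinear φ a := by
  obtain ⟨Φ, hΦ⟩ := exists_positive_extension hφ hr
  refine ⟨Φ.GNS, inferInstance, inferInstance, inferInstance, Φ.gnsStarAlgHom,
    (Φ.toPreGNS 1 : Φ.GNS), fun a => ?_⟩
  have h := inner_gns Φ 1 (regularRep G a)
  rw [map_one Φ.gnsStarAlgHom, star_one, one_mul, hΦ] at h
  exact h

/-! ### Reduced words and the weight function -/

section Words

variable {n : ℕ}

open FreeGroup

theorem isChain_and {α : Type*} {R S : α → α → Prop} {L : List α} (hR : L.IsChain R)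
    (hS : L.IsChain S) : L.IsChain fun a b => R a b ∧ S a b := by
  induction hR with
  | nil => simp
  | singleton => simp
  | cons_cons h _ ih =>
    rw [List.isChain_cons_cons] at hS ⊢
    exact ⟨⟨h, hS.1⟩, ih hS.2⟩

theorem countP_zip_tail_eq_zero_iff {α : Type*} (p : α × α → Prop) [DecidablePred p] (L : List α) :
    (L.zip L.tail).countP (fun q => p q) = 0 ↔ L.IsChain fun a b => ¬ p (a, b) := by
  induction L with
  | nil => simp
  | cons a L ih =>
    cases L with
    | nil => simp
    | cons b L =>
      rw [List.isChain_cons_cons, ← ih]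
      simp [List.countP_cons, and_comm]

/-- Since `u_k⁻¹ u_k` does not occur in a reduced word, `γ(s) = 0` says that no letter `u_j` comes
directly after a letter `u_k⁻¹`. -/
theorem gamma_eq_zero_iff (s : FreeGroup (Fin n)) :
    gamma s = 0 ↔ s.toWord.IsChain fun a b => a.2 = false → b.2 = false := by
  have hred : s.toWord.IsChain fun a b => a.1 = b.1 → a.2 = b.2 := isReduced_toWord
  unfold gamma
  rw [countP_zip_tail_eq_zero_iff (fun q : (Fin n × Bool) × (Fin n × Bool) =>
    q.1.2 = false ∧ q.2.2 = true ∧ q.1.1 ≠ q.2.1)]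
  constructor
  · intro h
    refine (isChain_and hred h).imp ?_
    rintro ⟨i, b⟩ ⟨j, c⟩ ⟨h1, h2⟩ h3
    cases c <;> grind
  · intro h
    refine h.imp ?_
    rintro ⟨i, b⟩ ⟨j, c⟩ h1 ⟨h2, h3, -⟩
    simp_all

theorem exists_eq_pos_append_neg {L : List (Fin n × Bool)}
    (h : L.IsChain fun a b => a.2 = false → b.2 = false) :
    ∃ P N : List (Fin n), L = P.map (·, true) ++ N.map (·, false) := by
  induction L with
  | nil => exact ⟨[], [], rfl⟩
  | cons a L ih =>
    obtain ⟨P, N, rfl⟩ := ih h.of_cons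
    obtain ⟨i, b⟩ := a
    cases b with
    | true => exact ⟨i :: P, N, rfl⟩
    | false =>
      cases P with
      | nil => exact ⟨[], i :: N, rfl⟩
      | cons j P => simp at h

theorem exists_neg_pos_of_not_isChain {L : List (Fin n × Bool)}
    (h : ¬ L.IsChain fun a b => a.2 = false → b.2 = false) :
    ∃ (A : List (Fin n × Bool)) (k j : Fin n) (B : List (Fin n × Bool)),
      L = A ++ (k, false) :: (j, true) :: B := by
  induction L with
  | nil => simp at h
  | cons a L ih =>
    cases L with
    | nil => simp at h
    | cons b L =>
      by_cases hL : (b :: L).IsChain fun a b => a.2 = false → b.2 = false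
      · rw [List.isChain_cons_cons] at h
        obtain ⟨i, x⟩ := a
        obtain ⟨j, y⟩ := b
        have hxy : x = false ∧ y = true := by grind
        exact ⟨[], i, j, L, by simp [hxy]⟩
      · obtain ⟨A, k, j, B, h⟩ := ih hL
        exact ⟨a :: A, k, j, B, by rw [h]; rfl⟩

theorem toWord_mk_of_isReduced {L : List (Fin n × Bool)} (h : FreeGroup.IsReduced L) :
    (mk L).toWord = L := by
  rw [toWord_mk, h.reduce_eq]

theorem isReduced_map_const (N : List (Fin n)) (b : Bool) : FreeGroup.IsReduced (N.map (·, b)) := by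
  unfold FreeGroup.IsReduced
  rw [List.isChain_map]
  exact (List.pairwise_of_forall fun _ _ _ => rfl).isChain

theorem invRev_map_true (P : List (Fin n)) :
    invRev (P.map (·, true)) = P.reverse.map (·, false) := by
  simp [invRev, Function.comp_def]

/-- The properties that single out `weightState w` among all functions: `φ` is hermitian, vanishes
where `γ ≠ 0`, and is multiplied by `conj w_i` when a letter `u_i⁻¹` is appended to a reduced
word. -/
theorem eq_weightState {w : Fin n → ℂ} {φ : FreeGroup (Fin n) → ℂ} (h1 : φ 1 = 1)
    (hinv : ∀ s, φ s⁻¹ = conj (φ s)) (hγ : ∀ s, gamma s ≠ 0 → φ s = 0)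
    (hrec : ∀ (L : List (Fin n × Bool)) (i : Fin n), FreeGroup.IsReduced (L ++ [(i, false)]) →
      φ (mk (L ++ [(i, false)])) = conj (w i) * φ (mk L)) :
    φ = weightState w := by
  have hneg : ∀ (N : List (Fin n)) (M : List (Fin n × Bool)),
      FreeGroup.IsReduced (M ++ N.map (·, false)) →
      φ (mk (M ++ N.map (·, false))) = (N.map fun i => conj (w i)).prod * φ (mk M) := by
    intro N
    induction N using List.reverseRecOn with
    | nil => simp
    | append_singleton N i ih =>
      intro M h
      rw [List.map_append, ← List.append_assoc] at h ⊢
      simp only [List.map_cons, List.map_nil, List.map_append, List.prod_append, List.prod_cons,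
        List.prod_nil, mul_one] at h ⊢
      rw [hrec _ _ h, ih _ (h.infix (List.infix_append [] _ _))]
      ring
  have hpos : ∀ P : List (Fin n), φ (mk (P.map (·, true))) = (P.map w).prod := by
    intro P
    have h := hneg P.reverse [] (by simpa using isReduced_map_const P.reverse false)
    rw [List.nil_append, ← invRev_map_true, ← inv_mk, hinv, ← one_eq_mk, h1, mul_one,
      List.map_reverse, List.prod_reverse] at h
    have h' := congrArg conj h
    rw [Complex.conj_conj, map_list_prod, List.map_map] at h'
    rw [h']
    congr 2
    funext i
    simp
  funext s
  unfold weightState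
  split_ifs with hs
  · obtain ⟨P, N, h⟩ := exists_eq_pos_append_neg ((gamma_eq_zero_iff s).1 hs)
    have hr : FreeGroup.IsReduced (P.map (·, true) ++ N.map (·, false)) := h ▸ isReduced_toWord
    conv_lhs => rw [← mk_toWord (x := s), h, hneg N _ hr, hpos]
    rw [h]
    simp [Function.comp_def, mul_comm]
  · exact hγ s hs

end Words

/-! ### First letters of reduced words -/

section FirstLetter

variable {n : ℕ}

open FreeGroup

/-- The elements of the free group whose reduced word starts with the letter `p`. -/
def startsWith (p : Fin n × Bool) : Set (FreeGroup (Fin n)) := {g | g.toWord.head? = some p}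

/-- The elements of the free group whose reduced word starts with the inverse of a generator. -/
def startsNeg (n : ℕ) : Set (FreeGroup (Fin n)) := ⋃ i, startsWith (i, false)

/-- The elements of the free group whose reduced word starts with `u_i` or `u_i⁻¹`. -/
def startsIndex (i : Fin n) : Set (FreeGroup (Fin n)) :=
  startsWith (i, true) ∪ startsWith (i, false)

theorem disjoint_startsWith {p q : Fin n × Bool} (h : p ≠ q) :
    Disjoint (startsWith p) (startsWith q) := by
  rw [Set.disjoint_left]
  intro g hp hq
  exact h (Option.some_injective _ (hp.symm.trans hq))

theorem disjoint_startsIndex {i j : Fin n} (h : i ≠ j) :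
    Disjoint (startsIndex i) (startsIndex j) := by
  simp only [startsIndex, Set.disjoint_union_left, Set.disjoint_union_right]
  refine ⟨⟨?_, ?_⟩, ?_, ?_⟩ <;> exact disjoint_startsWith (by simp [h])

/-- If `h` does not start with the inverse of the last letter of a reduced word, then nothing
cancels in the product of the two, which starts with the first letter of the reduced word. -/
theorem mk_mul_mem_startsWith {L : List (Fin n × Bool)} {p : Fin n × Bool} {i : Fin n} {b : Bool}
    (hL : FreeGroup.IsReduced (L ++ [(i, b)])) (hp : (L ++ [(i, b)]).head? = some p)
    {h : FreeGroup (Fin n)} (hh : h ∉ startsWith (i, !b)) :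
    mk (L ++ [(i, b)]) * h ∈ startsWith p := by
  have hred : FreeGroup.IsReduced ((L ++ [(i, b)]) ++ h.toWord) := by
    refine List.isChain_append.2 ⟨hL, isReduced_toWord, ?_⟩
    rintro x hx ⟨j, c⟩ hy
    simp only [List.getLast?_append, List.getLast?_singleton, Option.some_or, Option.mem_def,
      Option.some.injEq] at hx
    subst hx
    intro (hij : i = j)
    subst hij
    by_contra hbc
    refine hh ?_
    rw [startsWith, Set.mem_ofPred_eq, Option.mem_def.1 hy]
    cases b <;> cases c <;> simp_all
  change (mk (L ++ [(i, b)]) * h).toWord.head? = some p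
  conv_lhs => rw [← mk_toWord (x := h), mul_mk, toWord_mk_of_isReduced hred]
  rw [List.head?_append, hp]
  rfl

theorem of_mul_mem_startsWith_iff (i : Fin n) (h : FreeGroup (Fin n)) :
    of i * h ∈ startsWith (i, true) ↔ h ∉ startsWith (i, false) := by
  constructor
  · intro hm hs
    -- `h = u_i⁻¹ h'` reduced, and `h'` does not start with `u_i`
    obtain ⟨L, hL⟩ : ∃ L, h.toWord = (i, false) :: L := by
      change h.toWord.head? = _ at hs
      cases hw : h.toWord with
      | nil => simp [hw] at hs
      | cons a L => simp [hw] at hs; exact ⟨L, by rw [hs]⟩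
    have hr : FreeGroup.IsReduced ((i, false) :: L) := hL ▸ isReduced_toWord
    have hr' : FreeGroup.IsReduced L := hr.infix (List.suffix_cons _ _).isInfix
    have he : of i * h = mk L := by
      rw [← mk_toWord (x := h), hL, of, mul_mk]
      exact Quot.sound (Red.Step.cons_not (b := true))
    change (of i * h).toWord.head? = _ at hm
    rw [he, toWord_mk_of_isReduced hr'] at hm
    cases L with
    | nil => simp at hm
    | cons a L =>
      simp only [List.head?_cons, Option.some.injEq] at hm
      subst hm
      simp at hr
  · exact fun hh => mk_mul_mem_startsWith (L := []) (by simp) (by simp) hh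

theorem mem_startsWith_of_mul_mem_startsNeg {i : Fin n} {h : FreeGroup (Fin n)}
    (hh : of i * h ∈ startsNeg n) : h ∈ startsWith (i, false) := by
  by_contra hc
  obtain ⟨j, hj⟩ := Set.mem_iUnion.1 hh
  exact Set.disjoint_left.1 (disjoint_startsWith (by simp))
    ((of_mul_mem_startsWith_iff i h).2 hc) hj

end FirstLetter

/-! ### Indicator projections and covariant representations -/

section Indicator

variable {G : Type*}

theorem memlp_indicator (S : Set G) (f : EllTwo G) : Memℓp (S.indicator f) 2 :=
  (lp.memℓp f).mono' fun _ => norm_indicator_le_norm_self _ _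

/-- Multiplication by the indicator function of `S` on `ℓ²(G)`. -/
def indicatorOp (S : Set G) : EllTwo G →L[ℂ] EllTwo G :=
  LinearMap.mkContinuous
    { toFun := fun f => ⟨S.indicator f, memlp_indicator S f⟩
      map_add' := fun f g => lp.ext (Set.indicator_add S f g)
      map_smul' := fun z f => lp.ext (Set.indicator_const_smul S z f) } 1 fun f => by
    rw [one_mul]
    exact lp.norm_mono (by norm_num) fun _ => norm_indicator_le_norm_self _ _

theorem indicatorOp_apply (S : Set G) (f : EllTwo G) (h : G) :
    indicatorOp S f h = S.indicator f h := rfl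

theorem indicatorOp_mul (S T : Set G) : indicatorOp S * indicatorOp T = indicatorOp (S ∩ T) := by
  ext f h
  change S.indicator (T.indicator f) h = _
  rw [Set.indicator_indicator]; rfl

theorem star_indicatorOp (S : Set G) : star (indicatorOp S) = indicatorOp S := by
  rw [ContinuousLinearMap.star_eq_adjoint, eq_comm, ContinuousLinearMap.eq_adjoint_iff]
  intro x y
  rw [lp.inner_eq_tsum, lp.inner_eq_tsum]
  refine tsum_congr fun h => ?_
  by_cases hh : h ∈ S <;> simp [indicatorOp_apply, hh]

theorem indicatorOp_union {S T : Set G} (h : Disjoint S T) :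
    indicatorOp (S ∪ T) = indicatorOp S + indicatorOp T := by
  ext f g
  change (S ∪ T).indicator f g = S.indicator f g + T.indicator f g
  rw [Set.indicator_union_of_disjoint h]

theorem indicatorOp_empty : indicatorOp (∅ : Set G) = 0 := by
  ext f g
  change (∅ : Set G).indicator f g = 0
  simp

theorem indicatorOp_univ : indicatorOp (Set.univ : Set G) = 1 := by
  ext f g
  change (Set.univ : Set G).indicator f g = f g
  simp

theorem indicatorOp_mul_leftRegular [Group G] (T : Set G) (g : G) :
    indicatorOp T * leftRegular G g = leftRegular G g * indicatorOp {h | g * h ∈ T} := by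
  ext f h
  change T.indicator (leftRegular G g f) h = Set.indicator {h | g * h ∈ T} f (g⁻¹ * h)
  by_cases hh : h ∈ T <;> simp [hh, leftRegular_apply]

end Indicator

section Hilbert

variable {K : Type*} [NormedAddCommGroup K] [InnerProductSpace ℂ K]

/-- Pythagoras' theorem for a finite family of pairwise orthogonal vectors. -/
theorem norm_sum_sq_of_orthogonal {ι : Type*} [Fintype ι] {y : ι → K}
    (hy : ∀ i j, i ≠ j → inner ℂ (y i) (y j) = 0) : ‖∑ i, y i‖ ^ 2 = ∑ i, ‖y i‖ ^ 2 := by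
  have h : inner ℂ (∑ i, y i) (∑ i, y i) = ∑ i, inner ℂ (y i) (y i) := by
    rw [sum_inner]
    refine Finset.sum_congr rfl fun i _ => ?_
    rw [inner_sum]
    exact Finset.sum_eq_single i (fun j _ hj => hy i j hj.symm) (by simp)
  simp only [inner_self_eq_norm_sq_to_K] at h
  exact_mod_cast h

/-- The equality case of the Cauchy–Schwarz inequality
`‖∑ c_i x_i‖² ≤ (∑ |c_i|²) (∑ ‖x_i‖²)`. -/
theorem eq_conj_smul_of_sum_norm_sq_le {ι : Type*} [Fintype ι] {c : ι → ℂ} {x : ι → K} {y : K}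
    (hc : ∑ i, ‖c i‖ ^ 2 = 1) (hy : ∑ i, c i • x i = y) (hx : ∑ i, ‖x i‖ ^ 2 ≤ ‖y‖ ^ 2) (i : ι) :
    x i = conj (c i) • y := by
  have h1 : ∀ i, ‖x i - conj (c i) • y‖ ^ 2 =
      ‖x i‖ ^ 2 - 2 * (inner ℂ y (c i • x i)).re + ‖c i‖ ^ 2 * ‖y‖ ^ 2 := by
    intro i
    rw [@norm_sub_sq ℂ, norm_smul, mul_pow, RCLike.norm_conj, inner_smul_right, inner_smul_right]
    have h : (conj (c i) * inner ℂ (x i) y).re = (c i * inner ℂ y (x i)).re := by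
      rw [← inner_conj_symm, ← map_mul, Complex.conj_re]
    rw [← h]
    rfl
  have h2 : ∑ i, ‖x i - conj (c i) • y‖ ^ 2 = ∑ i, ‖x i‖ ^ 2 - ‖y‖ ^ 2 := by
    simp only [h1, Finset.sum_add_distrib, Finset.sum_sub_distrib, ← Finset.mul_sum,
      ← Finset.sum_mul, hc]
    rw [← Complex.re_sum, ← inner_sum, hy, inner_self_eq_norm_sq_to_K]
    rw [← RCLike.ofReal_pow]
    change _ - 2 * (‖y‖ ^ 2) + 1 * ‖y‖ ^ 2 = _
    ring
  have h3 : ∑ i, ‖x i - conj (c i) • y‖ ^ 2 = 0 :=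
    le_antisymm (by linarith) (Finset.sum_nonneg fun i _ => by positivity)
  rw [Finset.sum_eq_zero_iff_of_nonneg (fun i _ => by positivity)] at h3
  have h4 := h3 i (Finset.mem_univ i)
  rwa [sq_eq_zero_iff, norm_eq_zero, sub_eq_zero] at h4

end Hilbert

section Representation

variable {G : Type*} {K : Type*} [NormedAddCommGroup K] [InnerProductSpace ℂ K]
  [CompleteSpace K] (ρ : (EllTwo G →L[ℂ] EllTwo G) →⋆ₐ[ℂ] (K →L[ℂ] K))

/-- The projection-valued finitely additive measure on `G` contained in a representation of
`B(ℓ²(G))`. -/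
def repE (S : Set G) : K →L[ℂ] K := ρ (indicatorOp S)

theorem repE_repE (S T : Set G) (x : K) : repE ρ S (repE ρ T x) = repE ρ (S ∩ T) x := by
  rw [repE, repE, repE, ← indicatorOp_mul, map_mul]; rfl

theorem inner_repE_left (S : Set G) (x y : K) :
    inner ℂ (repE ρ S x) y = inner ℂ x (repE ρ S y) := by
  conv_rhs => rw [repE, ← star_indicatorOp, map_star, ContinuousLinearMap.star_eq_adjoint,
    ContinuousLinearMap.adjoint_inner_right]
  rfl

theorem repE_union_apply {S T : Set G} (h : Disjoint S T) (x : K) :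
    repE ρ (S ∪ T) x = repE ρ S x + repE ρ T x := by
  simp [repE, indicatorOp_union h]

theorem repE_empty_apply (x : K) : repE ρ ∅ x = 0 := by simp [repE, indicatorOp_empty]

theorem repE_univ_apply (x : K) : repE ρ Set.univ x = x := by simp [repE, indicatorOp_univ]

theorem repE_compl_apply (S : Set G) (x : K) : repE ρ Sᶜ x = x - repE ρ S x := by
  rw [eq_sub_iff_add_eq, add_comm, ← repE_union_apply ρ disjoint_compl_right, Set.union_compl_self,
    repE_univ_apply]

theorem inner_repE_repE_of_disjoint {S T : Set G} (h : Disjoint S T) (x y : K) :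
    inner ℂ (repE ρ S x) (repE ρ T y) = 0 := by
  rw [inner_repE_left, repE_repE, h.inter_eq, repE_empty_apply, inner_zero_right]

theorem norm_repE_union_sq {S T : Set G} (h : Disjoint S T) (x : K) :
    ‖repE ρ (S ∪ T) x‖ ^ 2 = ‖repE ρ S x‖ ^ 2 + ‖repE ρ T x‖ ^ 2 := by
  rw [repE_union_apply ρ h, sq, sq, sq]
  exact norm_add_sq_eq_norm_sq_add_norm_sq_of_inner_eq_zero _ _
    (inner_repE_repE_of_disjoint ρ h x x)

theorem norm_repE_compl_sq (S : Set G) (x : K) :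
    ‖repE ρ Sᶜ x‖ ^ 2 = ‖x‖ ^ 2 - ‖repE ρ S x‖ ^ 2 := by
  have h := norm_repE_union_sq ρ (disjoint_compl_right (a := S)) x
  rw [Set.union_compl_self, repE_univ_apply] at h
  linarith

theorem norm_repE_sq_sub {S T : Set G} (h : S ⊆ T) (x : K) :
    ‖repE ρ T x - repE ρ S x‖ ^ 2 = ‖repE ρ T x‖ ^ 2 - ‖repE ρ S x‖ ^ 2 := by
  have h1 := repE_union_apply ρ (Set.disjoint_sdiff_right (s := S) (t := T)) x
  have h2 := norm_repE_union_sq ρ (Set.disjoint_sdiff_right (s := S) (t := T)) x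
  rw [Set.union_sdiff_cancel h] at h1 h2
  rw [h1, add_sub_cancel_left, ← h1]
  linarith

theorem repE_eq_self_of_norm_eq {S : Set G} {x : K} (h : ‖repE ρ S x‖ ^ 2 = ‖x‖ ^ 2) :
    repE ρ S x = x := by
  have h1 := norm_repE_sq_sub ρ (Set.subset_univ S) x
  rw [repE_univ_apply, h, sub_self, sq_eq_zero_iff, norm_eq_zero, sub_eq_zero] at h1
  exact h1.symm

theorem repE_eq_self_mono {S T : Set G} (h : S ⊆ T) {x : K} (hx : repE ρ S x = x) :
    repE ρ T x = x := by
  rw [← hx, repE_repE, Set.inter_eq_self_of_subset_right h]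

theorem repE_iUnion_apply {ι : Type*} [Fintype ι] {S : ι → Set G}
    (hS : ∀ i j, i ≠ j → Disjoint (S i) (S j)) (x : K) :
    repE ρ (⋃ i, S i) x = ∑ i, repE ρ (S i) x := by
  classical
  have h : ∀ F : Finset ι, repE ρ (⋃ i ∈ F, S i) x = ∑ i ∈ F, repE ρ (S i) x := by
    intro F
    induction F using Finset.induction_on with
    | empty => simp [repE_empty_apply]
    | insert a F ha ih =>
      rw [Finset.set_biUnion_insert, repE_union_apply, ih, Finset.sum_insert ha]
      rw [Set.disjoint_iUnion₂_right]
      exact fun i hi => hS a i fun h => ha (h ▸ hi)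
  simpa using h Finset.univ

theorem norm_repE_iUnion_sq {ι : Type*} [Fintype ι] {S : ι → Set G}
    (hS : ∀ i j, i ≠ j → Disjoint (S i) (S j)) (x : K) :
    ‖repE ρ (⋃ i, S i) x‖ ^ 2 = ∑ i, ‖repE ρ (S i) x‖ ^ 2 := by
  rw [repE_iUnion_apply ρ hS, norm_sum_sq_of_orthogonal]
  exact fun i j hij => inner_repE_repE_of_disjoint ρ (hS i j hij) x x

variable [Group G]

/-- The unitary representation of `G` contained in a representation of `B(ℓ²(G))`. -/
def repU (g : G) : K →L[ℂ] K := ρ (leftRegular G g)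

theorem repU_mul_apply (g h : G) (x : K) : repU ρ (g * h) x = repU ρ g (repU ρ h x) := by
  simp [repU]

theorem repU_one_apply (x : K) : repU ρ 1 x = x := by
  simp [repU]

theorem inner_repU_left (g : G) (x y : K) :
    inner ℂ (repU ρ g x) y = inner ℂ x (repU ρ g⁻¹ y) := by
  rw [repU, repU, ← star_leftRegular, map_star, ContinuousLinearMap.star_eq_adjoint,
    ContinuousLinearMap.adjoint_inner_right]

theorem norm_repU (g : G) (x : K) : ‖repU ρ g x‖ = ‖x‖ := by
  rw [@norm_eq_sqrt_re_inner ℂ, inner_repU_left, ← repU_mul_apply, inv_mul_cancel, repU_one_apply,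
    ← @norm_eq_sqrt_re_inner ℂ]

theorem repE_repU (T : Set G) (g : G) (x : K) :
    repE ρ T (repU ρ g x) = repU ρ g (repE ρ {h | g * h ∈ T} x) := by
  have h := congrArg (fun A => ρ A x) (indicatorOp_mul_leftRegular T g)
  simpa [repE, repU] using h

/-- If `x` is supported in `S`, then `g x` is supported in any set that contains `g S`. -/
theorem repE_repU_eq_self {S T : Set G} {g : G} {x : K} (hx : repE ρ S x = x)
    (h : ∀ s ∈ S, g * s ∈ T) : repE ρ T (repU ρ g x) = repU ρ g x := by
  rw [repE_repU, repE_eq_self_mono ρ (T := {h | g * h ∈ T}) h hx]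

end Representation

/-! ### Uniqueness on the outer boundary -/

section Uniqueness

variable {n : ℕ} {K : Type*} [NormedAddCommGroup K] [InnerProductSpace ℂ K] [CompleteSpace K]
  (ρ : (EllTwo (FreeGroup (Fin n)) →L[ℂ] EllTwo (FreeGroup (Fin n))) →⋆ₐ[ℂ] (K →L[ℂ] K))
  {c : Fin n → ℂ} {ξ : K}

open FreeGroup

theorem repE_startsWith_repU_of (i : Fin n) (x : K) :
    repE ρ (startsWith (i, true)) (repU ρ (of i) x) =
      repU ρ (of i) (repE ρ (startsWith (i, false))ᶜ x) := by
  rw [repE_repU]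
  congr 3
  ext h
  exact of_mul_mem_startsWith_iff i h

/-- A unit eigenvector with eigenvalue one, for coefficients of square sum one, has no mass on the
words that start with the inverse of a generator, unless a single coefficient is nonzero. -/
theorem repE_startsNeg_eq_zero_or (hc : ∑ i, ‖c i‖ ^ 2 = 1) (hξ : ‖ξ‖ = 1)
    (h : ∑ i, c i • repU ρ (of i) ξ = ξ) :
    repE ρ (startsNeg n) ξ = 0 ∨ ∃ a, ∀ i, i ≠ a → c i = 0 := by
  set η := repE ρ (startsNeg n) ξ with hη
  let M : Fin n → Set (FreeGroup (Fin n)) := fun i => {h | of i * h ∈ startsNeg n}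
  let x : Fin n → K := fun i => repU ρ (of i) (repE ρ (M i) ξ)
  have hM : ∀ i, M i ⊆ startsWith (i, false) := fun i g hg => mem_startsWith_of_mul_mem_startsNeg hg
  have hdisj : ∀ i j : Fin n, i ≠ j →
      Disjoint (startsWith (i, false)) (startsWith (j, false)) :=
    fun i j hij => disjoint_startsWith (by simp [hij])
  have hηsq : ‖η‖ ^ 2 = ∑ i, ‖repE ρ (startsWith (i, false)) ξ‖ ^ 2 :=
    norm_repE_iUnion_sq ρ hdisj ξ
  have hxη : ∑ i, c i • x i = η := by
    conv_rhs => rw [hη, ← h, map_sum]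
    simp only [map_smul, repE_repU, x, M]
  have hle : ∀ i, 0 ≤ ‖repE ρ (startsWith (i, false)) ξ‖ ^ 2 - ‖repE ρ (M i) ξ‖ ^ 2 := fun i => by
    rw [← norm_repE_sq_sub ρ (hM i)]; positivity
  have hxsq : ∑ i, ‖x i‖ ^ 2 ≤ ‖η‖ ^ 2 := by
    rw [hηsq]
    refine Finset.sum_le_sum fun i _ => ?_
    simp only [x, norm_repU]
    linarith [hle i]
  have hx := eq_conj_smul_of_sum_norm_sq_le hc hxη hxsq
  have hMsq : ∀ i, ‖repE ρ (M i) ξ‖ ^ 2 = ‖c i‖ ^ 2 * ‖η‖ ^ 2 := by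
    intro i
    have h1 := congrArg (fun y => ‖y‖ ^ 2) (hx i)
    simpa [x, norm_repU, norm_smul, mul_pow] using h1
  -- the projections onto `M i` and onto the words starting with `u_i⁻¹` agree on `ξ`
  have hMN : ∀ i, repE ρ (M i) ξ = repE ρ (startsWith (i, false)) ξ := by
    have hsum : ∑ i, (‖repE ρ (startsWith (i, false)) ξ‖ ^ 2 - ‖repE ρ (M i) ξ‖ ^ 2) = 0 := by
      rw [Finset.sum_sub_distrib, ← hηsq]
      simp only [hMsq, ← Finset.sum_mul, hc, one_mul, sub_self]
    rw [Finset.sum_eq_zero_iff_of_nonneg (fun i _ => hle i)] at hsum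
    intro i
    have h1 := hsum i (Finset.mem_univ i)
    rw [← norm_repE_sq_sub ρ (hM i), sq_eq_zero_iff, _root_.norm_eq_zero, sub_eq_zero] at h1
    exact h1.symm
  -- so the part of `ξ` off the negative words is a sum of vectors with orthogonal supports
  have hζ : ∑ i, c i • repE ρ (startsWith (i, true)) (repU ρ (of i) ξ) = ξ - η := by
    have h1 : ∀ i, repE ρ (startsWith (i, true)) (repU ρ (of i) ξ) = repU ρ (of i) ξ - x i := by
      intro i
      rw [repE_startsWith_repU_of, repE_compl_apply, ← hMN, map_sub]
    simp only [h1, smul_sub, Finset.sum_sub_distrib, h, hxη]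
  have hζsq : ‖ξ - η‖ ^ 2 = ∑ i, ‖c i‖ ^ 2 * (1 - ‖c i‖ ^ 2 * ‖η‖ ^ 2) := by
    rw [← hζ, norm_sum_sq_of_orthogonal]
    · refine Finset.sum_congr rfl fun i _ => ?_
      rw [norm_smul, mul_pow, repE_startsWith_repU_of, norm_repU, norm_repE_compl_sq, ← hMN, hMsq,
        hξ, one_pow]
    · intro i j hij
      rw [inner_smul_left, inner_smul_right,
        inner_repE_repE_of_disjoint ρ (disjoint_startsWith (by simp [hij]))]
      simp
  have hζsq' : ‖ξ - η‖ ^ 2 = 1 - ‖η‖ ^ 2 := by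
    rw [hη, ← repE_compl_apply, norm_repE_compl_sq, hξ, one_pow]
  by_cases hη0 : η = 0
  · exact Or.inl hη0
  right
  have hpos : 0 < ‖η‖ ^ 2 := by positivity
  have hquart : ∑ i, ‖c i‖ ^ 2 * (1 - ‖c i‖ ^ 2) = 0 := by
    have h1 : ∑ i, ‖c i‖ ^ 2 * (1 - ‖c i‖ ^ 2 * ‖η‖ ^ 2) =
        1 - ‖η‖ ^ 2 + ‖η‖ ^ 2 * ∑ i, ‖c i‖ ^ 2 * (1 - ‖c i‖ ^ 2) := by
      rw [Finset.mul_sum, ← hc]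
      simp only [mul_sub, mul_one, Finset.sum_sub_distrib, ← Finset.mul_sum, hc]
      have h2 : ∑ i, ‖c i‖ ^ 2 * (‖c i‖ ^ 2 * ‖η‖ ^ 2) =
          ‖η‖ ^ 2 * ∑ i, ‖c i‖ ^ 2 * ‖c i‖ ^ 2 := by
        rw [Finset.mul_sum]
        exact Finset.sum_congr rfl fun i _ => by ring
      rw [h2]
      ring
    rw [← hζsq, hζsq'] at h1
    have h2 : ‖η‖ ^ 2 * ∑ i, ‖c i‖ ^ 2 * (1 - ‖c i‖ ^ 2) = 0 := by linarith
    exact (mul_eq_zero.1 h2).resolve_left hpos.ne'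
  have hc1 : ∀ i, ‖c i‖ ^ 2 ≤ 1 := fun i => by
    rw [← hc]
    exact Finset.single_le_sum (f := fun i => ‖c i‖ ^ 2) (fun i _ => by positivity)
      (Finset.mem_univ i)
  rw [Finset.sum_eq_zero_iff_of_nonneg
    (fun i _ => mul_nonneg (by positivity) (by linarith [hc1 i]))] at hquart
  obtain ⟨a, ha⟩ : ∃ a, c a ≠ 0 := by
    by_contra! h0
    simp [h0] at hc
  refine ⟨a, fun i hi => ?_⟩
  have ha1 : ‖c a‖ ^ 2 = 1 := by
    have := (mul_eq_zero.1 (hquart a (Finset.mem_univ a))).resolve_left (by positivity)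
    linarith
  have hsum := Finset.add_sum_erase Finset.univ (fun i => ‖c i‖ ^ 2) (Finset.mem_univ a)
  simp only [hc, ha1] at hsum
  have h0 : ‖c i‖ ^ 2 ≤ ∑ i ∈ Finset.univ.erase a, ‖c i‖ ^ 2 :=
    Finset.single_le_sum (f := fun i => ‖c i‖ ^ 2) (fun i _ => by positivity)
      (Finset.mem_erase.2 ⟨hi, Finset.mem_univ i⟩)
  have h1 : ‖c i‖ ^ 2 = 0 := le_antisymm (by linarith) (by positivity)
  simpa using h1

theorem head?_append_singleton {α : Type*} {L : List α} {x p : α} (h : (L ++ [x]).head? = some p)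
    (hL : L ≠ []) : L.head? = some p := by
  cases L with
  | nil => exact absurd rfl hL
  | cons a L => simpa using h

/-- A letter `u_i` after a letter `u_i⁻¹` cancels it. -/
theorem mk_append_neg_mul_of (L : List (Fin n × Bool)) (i : Fin n) :
    mk (L ++ [(i, false)]) * of i = mk L := by
  rw [of, mul_mk, List.append_assoc]
  exact Quot.sound (by simpa using Red.Step.not (L₁ := L) (L₂ := []) (x := i) (b := false))

theorem isReduced_append_neg_pos {L : List (Fin n × Bool)} {i l : Fin n}
    (hL : FreeGroup.IsReduced (L ++ [(i, false)])) (hil : i ≠ l) :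
    FreeGroup.IsReduced (L ++ [(i, false)] ++ [(l, true)]) := by
  refine List.isChain_append.2 ⟨hL, List.isChain_singleton _, ?_⟩
  rintro x hx y hy
  simp at hx hy
  subst hx hy
  exact fun h => absurd h hil

/-- If the eigenvector has no mass on the negative words, then `L ξ` lives on the words starting
with `u_j`, for each reduced word `L` starting with `u_j`. A last letter `u_i⁻¹` is removed with
the eigenvalue equation. -/
theorem repE_startsWith_repU_mk (h : ∑ i, c i • repU ρ (of i) ξ = ξ)
    (h0 : repE ρ (startsNeg n) ξ = 0) {j : Fin n} (L : List (Fin n × Bool))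
    (hL : FreeGroup.IsReduced L) (hj : L.head? = some (j, true)) :
    repE ρ (startsWith (j, true)) (repU ρ (mk L) ξ) = repU ρ (mk L) ξ := by
  have hsupp : repE ρ (startsNeg n)ᶜ ξ = ξ := by rw [repE_compl_apply, h0, sub_zero]
  have hpos : ∀ (L : List (Fin n × Bool)) (i : Fin n), FreeGroup.IsReduced (L ++ [(i, true)]) →
      (L ++ [(i, true)]).head? = some (j, true) →
      repE ρ (startsWith (j, true)) (repU ρ (mk (L ++ [(i, true)])) ξ) =
        repU ρ (mk (L ++ [(i, true)])) ξ := by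
    intro L i hL hj
    refine repE_repU_eq_self ρ hsupp fun s hs => mk_mul_mem_startsWith hL hj fun hs' => hs ?_
    exact Set.mem_iUnion.2 ⟨i, hs'⟩
  induction L using List.reverseRecOn with
  | nil => simp at hj
  | append_singleton L p ih =>
    obtain ⟨i, b⟩ := p
    cases b with
    | true => exact hpos L i hL hj
    | false =>
      have hne : L ≠ [] := by rintro rfl; simp at hj
      have hj' := head?_append_singleton hj hne
      have hterm : ∀ l, repE ρ (startsWith (j, true)) (repU ρ (mk (L ++ [(i, false)]) * of l) ξ) =
          repU ρ (mk (L ++ [(i, false)]) * of l) ξ := by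
        intro l
        by_cases hil : i = l
        · subst hil
          rw [mk_append_neg_mul_of]
          exact ih (hL.infix (List.prefix_append _ _).isInfix) hj'
        · rw [of, mul_mk]
          refine hpos _ l (isReduced_append_neg_pos hL hil) ?_
          rw [List.head?_append, hj]
          rfl
      conv_lhs => rw [← h]
      conv_rhs => rw [← h]
      rw [map_sum, map_sum]
      simp only [map_smul, ← repU_mul_apply, hterm]

/-- If only `c_a` is nonzero, then the eigenvector is an eigenvector of `u_a`, and its mass lies on
the words starting with `u_a` or `u_a⁻¹`; the conclusion follows as in
`repE_startsWith_repU_mk`, except that the last letters removed are `u_a` and `u_a⁻¹`. -/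
theorem repE_startsIndex_repU_mk_of_single (hc : ∑ i, ‖c i‖ ^ 2 = 1)
    (h : ∑ i, c i • repU ρ (of i) ξ = ξ) {a : Fin n} (ha : ∀ i, i ≠ a → c i = 0)
    {j : Fin n} (L : List (Fin n × Bool))
    (hL : FreeGroup.IsReduced L) (hj : L.head? = some (j, true)) :
    repE ρ (startsIndex j) (repU ρ (mk L) ξ) = repU ρ (mk L) ξ := by
  have hca : ‖c a‖ ^ 2 = 1 := by
    rw [← hc, eq_comm]
    exact Finset.sum_eq_single (f := fun i => ‖c i‖ ^ 2) a (fun i _ hi => by simp [ha i hi])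
      (by simp)
  have hca' : conj (c a) * c a = 1 := by rw [Complex.conj_mul', ← Complex.ofReal_pow, hca]; simp
  have hU : c a • repU ρ (of a) ξ = ξ := by
    rw [← Finset.sum_eq_single (s := Finset.univ) (f := fun i => c i • repU ρ (of i) ξ) a
      (fun i _ hi => by simp [ha i hi]) (by simp), h]
  have hUpos : repU ρ (of a) ξ = conj (c a) • ξ := by
    conv_rhs => rw [← hU]
    rw [smul_smul, hca', one_smul]
  have hUneg : repU ρ (of a)⁻¹ ξ = c a • ξ := by
    conv_lhs => rw [← hU]
    rw [map_smul, ← repU_mul_apply, inv_mul_cancel, repU_one_apply]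
  have hsupp : repE ρ (startsIndex a) ξ = ξ := by
    apply repE_eq_self_of_norm_eq
    have h1 : ‖repE ρ (startsWith (a, true)) ξ‖ ^ 2 =
        ‖ξ‖ ^ 2 - ‖repE ρ (startsWith (a, false)) ξ‖ ^ 2 := by
      rw [← norm_repE_compl_sq, ← norm_repU ρ (of a) (repE ρ (startsWith (a, false))ᶜ ξ),
        ← repE_startsWith_repU_of, hUpos,
        map_smul, norm_smul, mul_pow, RCLike.norm_conj, hca, one_mul]
    rw [startsIndex, norm_repE_union_sq ρ (disjoint_startsWith (by simp)), h1]
    ring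
  induction L using List.reverseRecOn with
  | nil => simp at hj
  | append_singleton L p ih =>
    obtain ⟨i, b⟩ := p
    by_cases hia : i = a
    · subst hia
      obtain ⟨z, hz⟩ : ∃ z : ℂ, repU ρ (mk (L ++ [(i, b)])) ξ = z • repU ρ (mk L) ξ := by
        rw [← mul_mk, repU_mul_apply]
        cases b with
        | true => exact ⟨conj (c i), by rw [← map_smul, ← hUpos]; rfl⟩
        | false => exact ⟨c i, by rw [← map_smul, ← hUneg]; rfl⟩
      rw [hz, map_smul]
      by_cases hne : L = []
      · subst hne
        have hij : i = j := by simp at hj; exact hj.1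
        subst hij
        rw [← one_eq_mk, repU_one_apply, hsupp]
      · rw [ih (hL.infix (List.prefix_append _ _).isInfix) (head?_append_singleton hj hne)]
    · refine repE_repU_eq_self ρ hsupp fun s hs =>
        Or.inl (mk_mul_mem_startsWith hL hj fun hs' => ?_)
      refine Set.disjoint_left.1 (disjoint_startsIndex hia) ?_ hs
      cases b
      · exact Or.inl hs'
      · exact Or.inr hs'

/-- Both cases of `repE_startsNeg_eq_zero_or` lead to the same conclusion on supports. -/
theorem repE_startsIndex_repU_mk (hc : ∑ i, ‖c i‖ ^ 2 = 1) (hξ : ‖ξ‖ = 1)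
    (h : ∑ i, c i • repU ρ (of i) ξ = ξ) {j : Fin n} (L : List (Fin n × Bool))
    (hL : FreeGroup.IsReduced L) (hj : L.head? = some (j, true)) :
    repE ρ (startsIndex j) (repU ρ (mk L) ξ) = repU ρ (mk L) ξ := by
  rcases repE_startsNeg_eq_zero_or ρ hc hξ h with h0 | ⟨a, ha⟩
  · exact repE_eq_self_mono ρ Set.subset_union_left (repE_startsWith_repU_mk ρ h h0 L hL hj)
  · exact repE_startsIndex_repU_mk_of_single ρ hc h ha L hL hj

/-- At `s = a u_k⁻¹ u_j b` the coefficient is an inner product of the orthogonal vectors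
`u_k a⁻¹ ξ` and `u_j b ξ`. -/
theorem inner_repU_eq_zero_of_gamma_ne_zero (hc : ∑ i, ‖c i‖ ^ 2 = 1) (hξ : ‖ξ‖ = 1)
    (h : ∑ i, c i • repU ρ (of i) ξ = ξ) {s : FreeGroup (Fin n)} (hs : gamma s ≠ 0) :
    inner ℂ ξ (repU ρ s ξ) = 0 := by
  rw [Ne, gamma_eq_zero_iff] at hs
  obtain ⟨A, k, j, B, hw⟩ := exists_neg_pos_of_not_isChain hs
  have hred : FreeGroup.IsReduced (A ++ (k, false) :: (j, true) :: B) := hw ▸ isReduced_toWord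
  have hkj : k ≠ j := by
    have h1 := hred.infix (L₁ := [(k, false), (j, true)]) ⟨A, B, by simp⟩
    simpa [FreeGroup.IsReduced] using h1
  have hB : FreeGroup.IsReduced ((j, true) :: B) := hred.infix ⟨A ++ [(k, false)], [], by simp⟩
  have hA : FreeGroup.IsReduced (A ++ [(k, false)]) := hred.infix ⟨[], (j, true) :: B, by simp⟩
  have hA' : FreeGroup.IsReduced (invRev (A ++ [(k, false)])) := by
    rw [isReduced_iff_reduce_eq, reduce_invRev, hA.reduce_eq]
  have hs' : s = (mk (invRev (A ++ [(k, false)])))⁻¹ * mk ((j, true) :: B) := by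
    rw [inv_mk, invRev_invRev, mul_mk, ← mk_toWord (x := s), hw]
    simp
  have h1 := repE_startsIndex_repU_mk ρ hc hξ h _ hB rfl
  have h2 := repE_startsIndex_repU_mk ρ hc hξ h (j := k) _ hA' (by simp [invRev])
  rw [hs', repU_mul_apply, ← inner_repU_left, ← h1, ← h2]
  exact inner_repE_repE_of_disjoint ρ (disjoint_startsIndex hkj) _ _

theorem inner_repU_eq_weightState (hc : ∑ i, ‖c i‖ ^ 2 = 1) (hξ : ‖ξ‖ = 1)
    (h : ∑ i, c i • repU ρ (of i) ξ = ξ) :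
    (fun s => inner ℂ ξ (repU ρ s ξ)) = weightState fun i => conj (c i) := by
  have hγ : ∀ s, gamma s ≠ 0 → inner ℂ ξ (repU ρ s ξ) = 0 := fun s hs =>
    inner_repU_eq_zero_of_gamma_ne_zero ρ hc hξ h hs
  refine eq_weightState ?_ ?_ hγ ?_
  · rw [repU_one_apply, inner_self_eq_norm_sq_to_K, hξ]
    simp
  · intro s
    rw [← inner_repU_left, inner_conj_symm]
  · intro L i hL
    rw [Complex.conj_conj]
    conv_lhs => rw [← h, map_sum, inner_sum]; rw [h]
    rw [Finset.sum_eq_single i]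
    · rw [map_smul, inner_smul_right, ← repU_mul_apply, mk_append_neg_mul_of]
    · intro l _ hl
      rw [map_smul, inner_smul_right, ← repU_mul_apply, hγ, mul_zero]
      rw [of, mul_mk, Ne, gamma_eq_zero_iff,
        toWord_mk_of_isReduced (isReduced_append_neg_pos hL hl.symm)]
      intro hch
      have := (List.isChain_append.1 hch).2.2 (i, false) (by simp) (l, true) (by simp) rfl
      simp at this
    · simp

end Uniqueness

/-- In a representation, an eigenstate is given by an eigenvector. -/
theorem apply_eq_smul_of_isEigen {G : Type*} [Group G] {K : Type*} [NormedAddCommGroup K]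
    [InnerProductSpace ℂ K] [CompleteSpace K]
    (ρ : (EllTwo G →L[ℂ] EllTwo G) →⋆ₐ[ℂ] (K →L[ℂ] K)) {ξ : K} {φ : G → ℂ}
    (hρ : ∀ a, inner ℂ ξ (ρ (regularRep G a) ξ) = extendLinear φ a)
    {X : MonoidAlgebra ℂ G} {l : ℂ} (h : IsEigen X l φ) : ρ (regularRep G X) ξ = l • ξ := by
  have h1 : involution X - algebraMap ℂ (MonoidAlgebra ℂ G) (conj l) =
      involutionHom (X - algebraMap ℂ (MonoidAlgebra ℂ G) l) := by
    rw [map_sub, involutionHom_algebraMap, involutionHom_apply]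
  rw [IsEigen, h1, ← extendLinear_apply, ← hρ, map_mul (regularRep G), regularRep_involution,
    map_mul ρ, map_star, ContinuousLinearMap.star_eq_adjoint, mul_apply_eq_comp,
    ContinuousLinearMap.adjoint_inner_right, inner_self_eq_zero, map_sub, map_sub,
    AlgHomClass.commutes, AlgHomClass.commutes] at h
  rw [← sub_eq_zero, ← h]
  simp [Algebra.algebraMap_eq_smul_one]

theorem ne_zero_of_norm_sq_eq_sum {n : ℕ} {c : Fin n → ℂ} (hc : c ≠ 0) {l : ℂ}
    (hl : ‖l‖ ^ 2 = ∑ i, ‖c i‖ ^ 2) : l ≠ 0 := by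
  rintro rfl
  apply hc
  rw [norm_zero, zero_pow two_ne_zero, eq_comm,
    Finset.sum_eq_zero_iff_of_nonneg (fun i _ => by positivity)] at hl
  funext i
  simpa using hl i (Finset.mem_univ i)

/-- On the outer boundary of the annulus there is at most one reduced eigenstate. -/
theorem IsReducedEigenstate.eq_weightState {n : ℕ} {c : Fin n → ℂ} (hc0 : c ≠ 0) {l : ℂ}
    (hl : ‖l‖ ^ 2 = ∑ i, ‖c i‖ ^ 2) {φ : FreeGroup (Fin n) → ℂ}
    (h : IsReducedEigenstate (genSum c) l φ) :
    φ = weightState fun i => conj (c i / l) := by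
  have hl0 := ne_zero_of_norm_sq_eq_sum hc0 hl
  obtain ⟨K, _, _, _, ρ, ξ, hρ⟩ := exists_representation h.state h.reduced
  have hφ : ∀ s, inner ℂ ξ (repU ρ s ξ) = φ s := by
    intro s
    have h1 := hρ (MonoidAlgebra.single s 1)
    simpa [repU] using h1
  have hξ : ‖ξ‖ = 1 := by
    have h1 := hφ 1
    rw [repU_one_apply, h.state.unital, inner_self_eq_norm_sq_to_K] at h1
    have h2 : ‖ξ‖ ^ 2 = 1 := Complex.ofReal_injective (by simpa using h1)
    exact (pow_eq_one_iff_of_nonneg (norm_nonneg ξ) two_ne_zero).1 h2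
  have heig := apply_eq_smul_of_isEigen ρ hρ h.eigen
  have hsum : ∑ i, (c i / l) • repU ρ (FreeGroup.of i) ξ = ξ := by
    have h1 : ρ (regularRep _ (genSum c)) ξ = ∑ i, c i • repU ρ (FreeGroup.of i) ξ := by
      simp [genSum, repU, map_sum]
    rw [h1] at heig
    simp only [div_eq_inv_mul, mul_smul]
    rw [← Finset.smul_sum, heig, smul_smul, inv_mul_cancel₀ hl0, one_smul]
  have hc : ∑ i, ‖c i / l‖ ^ 2 = 1 := by
    simp only [norm_div, div_pow, ← Finset.sum_div, ← hl]
    exact div_self (by positivity)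
  rw [← inner_repU_eq_weightState ρ hc hξ hsum]
  exact (funext hφ).symm

/-! ### Existence on the outer boundary -/

section Limit

open Filter Topology

variable {G : Type*} [Group G]

theorem norm_leftRegular_apply (g : G) (f : EllTwo G) : ‖leftRegular G g f‖ = ‖f‖ :=
  (leftTranslate g).norm_map f

theorem inner_star_mul_self {H : Type*} [NormedAddCommGroup H] [InnerProductSpace ℂ H]
    [CompleteSpace H] (T : H →L[ℂ] H) (x : H) :
    inner ℂ x ((star T * T) x) = ((‖T x‖ ^ 2 : ℝ) : ℂ) := by
  rw [ContinuousLinearMap.star_eq_adjoint, mul_apply_eq_comp,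
    ContinuousLinearMap.adjoint_inner_right, inner_self_eq_norm_sq_to_K]
  norm_cast

/-- An approximate eigenvector in `ℓ²(G)` gives a reduced eigenstate: a limit of its vector states
along an ultrafilter. -/
theorem exists_isReducedEigenstate_of_tendsto {X : MonoidAlgebra ℂ G} {l : ℂ} {x : ℕ → EllTwo G}
    (hx : ∀ m, ‖x m‖ = 1)
    (h : Tendsto (fun m => ‖regularRep G X (x m) - l • x m‖) atTop (𝓝 0)) :
    ∃ φ : G → ℂ, IsReducedEigenstate X l φ := by
  have hlim : ∀ s : G, ∃ z : ℂ,
      Tendsto (fun m => inner ℂ (x m) (leftRegular G s (x m))) (hyperfilter ℕ) (𝓝 z) := by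
    intro s
    have hb : ∀ m, inner ℂ (x m) (leftRegular G s (x m)) ∈ Metric.closedBall (0 : ℂ) 1 := by
      intro m
      rw [mem_closedBall_zero_iff]
      refine (norm_inner_le_norm _ _).trans ?_
      rw [norm_leftRegular_apply, hx, one_mul]
    obtain ⟨z, -, hz⟩ := (isCompact_closedBall (0 : ℂ) 1).ultrafilter_le_nhds
      ((hyperfilter ℕ).map fun m => inner ℂ (x m) (leftRegular G s (x m)))
      (tendsto_principal.2 (Eventually.of_forall hb))
    exact ⟨z, hz⟩
  choose φ hφ using hlim
  have hext : ∀ a : MonoidAlgebra ℂ G, Tendsto (fun m => inner ℂ (x m) (regularRep G a (x m)))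
      (hyperfilter ℕ) (𝓝 (extendLinear φ a)) := by
    intro a
    induction a using groupAlgebra_induction with
    | h0 => simp
    | h1 g z => simpa [inner_smul_right] using (hφ g).const_mul z
    | h2 a b ha hb => simpa [inner_add_right] using ha.add hb
  have hsq : ∀ a : MonoidAlgebra ℂ G, Tendsto (fun m => ((‖regularRep G a (x m)‖ ^ 2 : ℝ) : ℂ))
      (hyperfilter ℕ) (𝓝 (extendLinear φ (involutionHom a * a))) := by
    intro a
    have h1 := hext (involutionHom a * a)
    simpa only [map_mul (regularRep G), regularRep_involution, inner_star_mul_self] using h1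
  refine ⟨φ, ⟨?_, ?_⟩, ⟨1, fun a => ?_⟩, ?_⟩
  · refine tendsto_nhds_unique (hφ 1) ?_
    have : ∀ m, inner ℂ (x m) (leftRegular G 1 (x m)) = 1 := by
      intro m
      rw [map_one]
      change inner ℂ (x m) (x m) = 1
      rw [inner_self_eq_norm_sq_to_K, hx]
      simp
    simp only [this]
    exact tendsto_const_nhds
  · intro F a
    have h1 : extendLinear φ (involutionHom (∑ s ∈ F, MonoidAlgebra.single s (a s)) *
        ∑ s ∈ F, MonoidAlgebra.single s (a s)) =
        ∑ s ∈ F, ∑ t ∈ F, conj (a s) * a t * φ (s⁻¹ * t) := by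
      simp [Finset.sum_mul_sum, MonoidAlgebra.single_mul_single]
    rw [← h1]
    refine ge_of_tendsto (hsq _) (Eventually.of_forall fun m => ?_)
    exact Complex.zero_le_real.2 (sq_nonneg _)
  · refine le_of_tendsto (hext a).norm (Eventually.of_forall fun m => ?_)
    calc _ ≤ ‖x m‖ * ‖regularRep G a (x m)‖ := norm_inner_le_norm _ _
      _ ≤ ‖x m‖ * (‖regularRep G a‖ * ‖x m‖) := by gcongr; exact ContinuousLinearMap.le_opNorm _ _
      _ = 1 * ‖regularRep G a‖ := by rw [hx]; ring
  · have h1 := hsq (X - algebraMap ℂ _ l)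
    have h2 : Tendsto (fun m => ((‖regularRep G (X - algebraMap ℂ _ l) (x m)‖ ^ 2 : ℝ) : ℂ))
        (hyperfilter ℕ) (𝓝 ((0 ^ 2 : ℝ) : ℂ)) := by
      refine (Complex.continuous_ofReal.tendsto _).comp (Tendsto.pow ?_ 2)
      refine (h.mono_left Nat.hyperfilter_le_atTop).congr fun m => ?_
      rw [map_sub, AlgHomClass.commutes]
      simp [Algebra.algebraMap_eq_smul_one]
    have h3 := tendsto_nhds_unique h1 h2
    rw [map_sub, involutionHom_algebraMap, involutionHom_apply] at h3
    rw [IsEigen, ← extendLinear_apply, h3]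
    simp

end Limit

section Existence

open Filter Topology FreeGroup

variable {n : ℕ}

/-- The products of `m` generators. -/
def positiveWords (n m : ℕ) : Set (FreeGroup (Fin n)) :=
  {h | ∃ P : List (Fin n), P.length = m ∧ h = FreeGroup.mk (P.map (·, true))}

theorem toWord_mk_map_true (P : List (Fin n)) :
    (FreeGroup.mk (P.map (·, true))).toWord = P.map (·, true) :=
  toWord_mk_of_isReduced (isReduced_map_const P true)

theorem disjoint_positiveWords {m m' : ℕ} (h : m ≠ m') :
    Disjoint (positiveWords n m) (positiveWords n m') := by
  rw [Set.disjoint_left]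
  rintro s ⟨P, rfl, rfl⟩ ⟨P', rfl, hs⟩
  have h1 := congrArg (fun g => g.toWord.length) hs
  simp only [toWord_mk_map_true, List.length_map] at h1
  exact h h1

theorem of_mul_mem_positiveWords {m : ℕ} {s : FreeGroup (Fin n)} (hs : s ∈ positiveWords n m)
    (i : Fin n) : of i * s ∈ positiveWords n (m + 1) := by
  obtain ⟨P, rfl, rfl⟩ := hs
  exact ⟨i :: P, rfl, by rw [of, mul_mk]; rfl⟩

theorem of_mul_mem_startsWith_of_positive {m : ℕ} {s : FreeGroup (Fin n)}
    (hs : s ∈ positiveWords n m) (i : Fin n) : of i * s ∈ startsWith (i, true) := by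
  rw [of_mul_mem_startsWith_iff]
  obtain ⟨P, rfl, rfl⟩ := hs
  intro h
  change (FreeGroup.mk _).toWord.head? = _ at h
  rw [toWord_mk_map_true] at h
  cases P <;> simp at h

/-- The vector `(∑ c_i u_i)^m δ_1` of `ℓ²`. -/
def powerVector (c : Fin n → ℂ) : ℕ → EllTwo (FreeGroup (Fin n))
  | 0 => lp.single 2 1 1
  | m + 1 => ∑ i, c i • leftRegular _ (of i) (powerVector c m)

theorem indicatorOp_powerVector (c : Fin n → ℂ) (m : ℕ) :
    indicatorOp (positiveWords n m) (powerVector c m) = powerVector c m := by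
  induction m with
  | zero =>
    ext h
    rw [indicatorOp_apply]
    by_cases hh : h ∈ positiveWords n 0
    · rw [Set.indicator_of_mem hh]
    · rw [Set.indicator_of_notMem hh]
      have h1 : h ≠ 1 := by rintro rfl; exact hh ⟨[], rfl, rfl⟩
      exact (lp.single_apply_ne (E := fun _ => ℂ) 2 _ _ h1).symm
  | succ m ih =>
    rw [powerVector, map_sum]
    refine Finset.sum_congr rfl fun i _ => ?_
    rw [map_smul]
    congr 1
    exact repE_repU_eq_self (StarAlgHom.id ℂ _) ih fun s hs => of_mul_mem_positiveWords hs i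

theorem norm_powerVector {c : Fin n → ℂ} (hc : ∑ i, ‖c i‖ ^ 2 = 1) (m : ℕ) :
    ‖powerVector c m‖ = 1 := by
  induction m with
  | zero => simp [powerVector, lp.norm_single]
  | succ m ih =>
    have hs : ∀ i, indicatorOp (startsWith (i, true)) (leftRegular _ (of i) (powerVector c m)) =
        leftRegular _ (of i) (powerVector c m) := fun i =>
      repE_repU_eq_self (StarAlgHom.id ℂ _) (indicatorOp_powerVector c m)
        fun s hs => of_mul_mem_startsWith_of_positive hs i
    have h : ‖powerVector c (m + 1)‖ ^ 2 = 1 := by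
      rw [powerVector, norm_sum_sq_of_orthogonal]
      · simp only [norm_smul, norm_leftRegular_apply, ih, mul_one, hc]
      · intro i j hij
        have h0 := inner_repE_repE_of_disjoint (StarAlgHom.id ℂ _)
          (disjoint_startsWith (p := (i, true)) (q := (j, true)) (by simp [hij]))
          (leftRegular _ (of i) (powerVector c m)) (leftRegular _ (of j) (powerVector c m))
        change inner ℂ (indicatorOp _ _) (indicatorOp _ _) = 0 at h0
        rw [hs, hs] at h0
        rw [inner_smul_left, inner_smul_right, h0]
        simp
    exact (pow_eq_one_iff_of_nonneg (_root_.norm_nonneg _) two_ne_zero).1 h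

theorem inner_powerVector_of_ne (c : Fin n → ℂ) {m m' : ℕ} (h : m ≠ m') :
    inner ℂ (powerVector c m) (powerVector c m') = 0 := by
  rw [← indicatorOp_powerVector c m, ← indicatorOp_powerVector c m']
  exact inner_repE_repE_of_disjoint (StarAlgHom.id ℂ _) (disjoint_positiveWords h) _ _

/-- On the outer boundary of the annulus there is a reduced eigenstate: normalized sums of the
orthonormal vectors `(∑ (c_i / l) u_i)^m δ_1` are approximate eigenvectors. -/
theorem exists_isReducedEigenstate {c : Fin n → ℂ} {l : ℂ} (hl0 : l ≠ 0)
    (hl : ‖l‖ ^ 2 = ∑ i, ‖c i‖ ^ 2) :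
    ∃ φ : FreeGroup (Fin n) → ℂ, IsReducedEigenstate (genSum c) l φ := by
  set d : Fin n → ℂ := fun i => c i / l with hd
  have hc : ∑ i, ‖d i‖ ^ 2 = 1 := by
    simp only [hd, norm_div, div_pow, ← Finset.sum_div, ← hl]
    exact div_self (by positivity)
  have hX : ∀ f, regularRep _ (genSum c) f = l • ∑ i, d i • leftRegular _ (of i) f := by
    intro f
    simp only [genSum, map_sum, regularRep_single, Finset.smul_sum, smul_smul, hd,
      mul_div_cancel₀ _ hl0]
    simp
  let y : ℕ → EllTwo (FreeGroup (Fin n)) := fun M => ∑ m ∈ Finset.range (M + 1), powerVector d m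
  have hy : ∀ M, ‖y M‖ = √((M : ℝ) + 1) := by
    intro M
    have h1 : ‖∑ m : Fin (M + 1), powerVector d m‖ ^ 2 = (M : ℝ) + 1 := by
      rw [norm_sum_sq_of_orthogonal fun i j hij =>
        inner_powerVector_of_ne d fun h => hij (Fin.ext h)]
      simp [norm_powerVector hc]
    rw [← h1, Real.sqrt_sq (_root_.norm_nonneg _), Fin.sum_univ_eq_sum_range (powerVector d)]
  have hpos : ∀ M : ℕ, 0 < √((M : ℝ) + 1) := fun M => Real.sqrt_pos.2 (by positivity)
  have hyX : ∀ M, regularRep _ (genSum c) (y M) - l • y M =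
      l • (powerVector d (M + 1) - powerVector d 0) := by
    intro M
    have h1 : ∑ i, d i • leftRegular _ (of i) (y M) =
        ∑ m ∈ Finset.range (M + 1), powerVector d (m + 1) := by
      simp only [y, map_sum, Finset.smul_sum]
      rw [Finset.sum_comm]
      rfl
    rw [hX, h1, ← smul_sub, ← Finset.sum_sub_distrib, Finset.sum_range_sub]
  refine exists_isReducedEigenstate_of_tendsto
    (x := fun M => ((√((M : ℝ) + 1))⁻¹ : ℂ) • y M) (fun M => ?_) ?_
  · rw [norm_smul, hy, norm_inv, Complex.norm_real, Real.norm_of_nonneg (hpos M).le,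
      inv_mul_cancel₀ (hpos M).ne']
  · have hb : Tendsto (fun M : ℕ => (√((M : ℝ) + 1))⁻¹ * (‖l‖ * 2)) atTop (𝓝 0) := by
      rw [← zero_mul (‖l‖ * 2)]
      refine Tendsto.mul_const _ (tendsto_inv_atTop_zero.comp (Real.tendsto_sqrt_atTop.comp ?_))
      exact tendsto_atTop_add_const_right _ _ tendsto_natCast_atTop_atTop
    refine squeeze_zero (fun M => _root_.norm_nonneg _) (fun M => ?_) hb
    rw [map_smul, smul_comm l, ← smul_sub, hyX, norm_smul, norm_smul, norm_inv, Complex.norm_real,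
      Real.norm_of_nonneg (hpos M).le]
    gcongr
    refine (norm_sub_le _ _).trans ?_
    rw [norm_powerVector hc, norm_powerVector hc]
    norm_num

end Existence

/-! ### Transport along an isomorphism of groups -/

section Transport

variable {G G' : Type*} [Group G] [Group G']

theorem memlp_comp_equiv (e : G ≃* G') (f : EllTwo G') : Memℓp (fun h : G => f (e h)) 2 := by
  have hp : 0 < (2 : ENNReal).toReal := by norm_num
  exact memℓp_gen (e.toEquiv.summable_iff.mpr ((lp.memℓp f).summable hp))

/-- Composition with a group isomorphism, as an isometry of `ℓ²` spaces. -/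
def compEquiv (e : G ≃* G') : EllTwo G' →ₗᵢ[ℂ] EllTwo G where
  toFun f := ⟨fun h => f (e h), memlp_comp_equiv e f⟩
  map_add' _ _ := rfl
  map_smul' _ _ := rfl
  norm_map' f := by
    have hp : 0 < (2 : ENNReal).toReal := by norm_num
    rw [lp.norm_eq_tsum_rpow hp, lp.norm_eq_tsum_rpow hp]
    congr 1
    exact e.toEquiv.tsum_eq (fun h => ‖f h‖ ^ (2 : ENNReal).toReal)

theorem compEquiv_leftRegular (e : G ≃* G') (g : G) (f : EllTwo G') :
    compEquiv e (leftRegular G' (e g) f) = leftRegular G g (compEquiv e f) := by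
  ext h
  change f ((e g)⁻¹ * e h) = f (e (g⁻¹ * h))
  simp

theorem compEquiv_regularRep (e : G ≃* G') (a : MonoidAlgebra ℂ G) (f : EllTwo G') :
    compEquiv e (regularRep G' (MonoidAlgebra.mapDomainRingHom ℂ (e : G →* G') a) f) =
      regularRep G a (compEquiv e f) := by
  induction a using groupAlgebra_induction with
  | h0 => simp
  | h1 g z =>
    have h := compEquiv_leftRegular e g f
    simp [MonoidAlgebra.mapDomainRingHom_apply, MonoidAlgebra.mapDomain_single, h]
  | h2 a b ha hb => simp only [map_add, add_apply, ha, hb]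

theorem norm_regularRep_mapDomain_le (e : G ≃* G') (a : MonoidAlgebra ℂ G) :
    ‖regularRep G' (MonoidAlgebra.mapDomainRingHom ℂ (e : G →* G') a)‖ ≤ ‖regularRep G a‖ := by
  refine ContinuousLinearMap.opNorm_le_bound _ (norm_nonneg _) fun f => ?_
  rw [← (compEquiv e).norm_map, compEquiv_regularRep, ← (compEquiv e).norm_map f]
  exact ContinuousLinearMap.le_opNorm _ _

theorem extendLinear_comp (e : G ≃* G') (φ : G' → ℂ) (a : MonoidAlgebra ℂ G) :
    extendLinear (fun g => φ (e g)) a =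
      extendLinear φ (MonoidAlgebra.mapDomainRingHom ℂ (e : G →* G') a) := by
  induction a using groupAlgebra_induction with
  | h0 => simp
  | h1 g z => simp [MonoidAlgebra.mapDomainRingHom_apply, MonoidAlgebra.mapDomain_single]
  | h2 a b ha hb => simp only [map_add, ha, hb]

theorem mapDomain_involution (e : G ≃* G') (a : MonoidAlgebra ℂ G) :
    MonoidAlgebra.mapDomainRingHom ℂ (e : G →* G') (involutionHom a) =
      involutionHom (MonoidAlgebra.mapDomainRingHom ℂ (e : G →* G') a) := by
  induction a using groupAlgebra_induction with
  | h0 => simp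
  | h1 g z => simp [MonoidAlgebra.mapDomainRingHom_apply, MonoidAlgebra.mapDomain_single]
  | h2 a b ha hb => simp only [map_add, ha, hb]

theorem IsState.comp {φ : G' → ℂ} (h : IsState φ) (e : G ≃* G') :
    IsState fun g => φ (e g) := by
  refine ⟨by simp [h.unital], fun F a => ?_⟩
  have h1 := h.posDef (F.map e.toEquiv.toEmbedding) (fun g => a (e.symm g))
  simpa using h1

theorem IsReduced.comp {φ : G' → ℂ} (h : IsState φ) (hr : IsReduced φ) (e : G ≃* G') :
    IsReduced fun g => φ (e g) := by
  refine ⟨1, fun a => ?_⟩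
  rw [← extendLinear_apply, extendLinear_comp, one_mul]
  exact (norm_extend_le h hr _).trans (norm_regularRep_mapDomain_le e a)

theorem involutionHom_single_mul (g : G) (z : ℂ) (b : MonoidAlgebra ℂ G) :
    involutionHom (MonoidAlgebra.single g z * b) =
      involutionHom b * MonoidAlgebra.single g⁻¹ (conj z) := by
  induction b using groupAlgebra_induction with
  | h0 => simp
  | h1 h w => simp [MonoidAlgebra.single_mul_single, mul_comm]
  | h2 a b ha hb => simp [mul_add, add_mul, ha, hb]

/-- Eigenstates correspond to each other under an isomorphism that carries `Y - m` to `X - l` up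
to a factor `-g`, since `-g` is unitary. -/
theorem IsReducedEigenstate.comp {X : MonoidAlgebra ℂ G'} {Y : MonoidAlgebra ℂ G} {l m : ℂ}
    {φ : G' → ℂ} (h : IsReducedEigenstate X l φ) (e : G ≃* G') (g : G')
    (hXY : MonoidAlgebra.mapDomainRingHom ℂ (e : G →* G') (Y - algebraMap ℂ _ m) =
      MonoidAlgebra.single g (-1) * (X - algebraMap ℂ _ l)) :
    IsReducedEigenstate Y m fun s => φ (e s) := by
  refine ⟨h.state.comp e, IsReduced.comp h.state h.reduced e, ?_⟩
  have h1 := h.eigen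
  unfold IsEigen at h1 ⊢
  rw [← involutionHom_apply, ← involutionHom_algebraMap, ← map_sub, ← extendLinear_apply] at h1 ⊢
  rw [extendLinear_comp, map_mul, mapDomain_involution, hXY, involutionHom_single_mul, mul_assoc,
    ← mul_assoc (MonoidAlgebra.single g⁻¹ _), MonoidAlgebra.single_mul_single]
  simpa [← MonoidAlgebra.one_def] using h1

end Transport

/-! ### The inner boundary -/

section InnerBoundary

open FreeGroup

variable {n : ℕ}

/-- The endomorphism `u_j ↦ u_j⁻¹`, `u_i ↦ u_j⁻¹ u_i` (`i ≠ j`) of the free group. -/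
def twistHom (j : Fin n) : FreeGroup (Fin n) →* FreeGroup (Fin n) :=
  lift fun i => if i = j then (of j)⁻¹ else (of j)⁻¹ * of i

theorem twistHom_of_self (j : Fin n) : twistHom j (of j) = (of j)⁻¹ := by simp [twistHom]

theorem twistHom_of_ne {i j : Fin n} (h : i ≠ j) : twistHom j (of i) = (of j)⁻¹ * of i := by
  simp [twistHom, h]

theorem twistHom_twistHom (j : Fin n) (s : FreeGroup (Fin n)) :
    twistHom j (twistHom j s) = s := by
  have h : (twistHom j).comp (twistHom j) = MonoidHom.id _ := by
    refine FreeGroup.ext_hom _ _ fun i => ?_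
    by_cases hi : i = j
    · subst hi
      simp [twistHom_of_self]
    · simp [twistHom_of_self, twistHom_of_ne hi]
  exact DFunLike.congr_fun h s

/-- The involutive automorphism `u_j ↦ u_j⁻¹`, `u_i ↦ u_j⁻¹ u_i` (`i ≠ j`) of the free group. -/
def twist (j : Fin n) : FreeGroup (Fin n) ≃* FreeGroup (Fin n) where
  toFun := twistHom j
  invFun := twistHom j
  left_inv := twistHom_twistHom j
  right_inv := twistHom_twistHom j
  map_mul' := map_mul _

/-- The coefficients of the equation `c_j ξ = l u_j⁻¹ ξ - ∑_{i ≠ j} c_i u_j⁻¹ u_i ξ`, which is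
equivalent to `∑ c_i u_i ξ = l ξ`. -/
def twistCoeff (c : Fin n → ℂ) (j : Fin n) (l : ℂ) (i : Fin n) : ℂ := if i = j then l else -c i

theorem genSum_eq_add_sum_erase (c : Fin n → ℂ) (j : Fin n) :
    genSum c = MonoidAlgebra.single (of j) (c j) +
      ∑ i ∈ Finset.univ.erase j, MonoidAlgebra.single (of i) (c i) :=
  (Finset.add_sum_erase _ _ (Finset.mem_univ j)).symm

theorem mapDomain_twist_genSum (c : Fin n → ℂ) (j : Fin n) (l : ℂ) :
    MonoidAlgebra.mapDomainRingHom ℂ (twist j : FreeGroup (Fin n) →* FreeGroup (Fin n))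
        (genSum (twistCoeff c j l) - algebraMap ℂ _ (c j)) =
      MonoidAlgebra.single (of j)⁻¹ (-1) * (genSum c - algebraMap ℂ _ l) := by
  have h1 : ∀ i, (twist j : FreeGroup (Fin n) →* FreeGroup (Fin n)) (of i) = twistHom j (of i) :=
    fun _ => rfl
  rw [genSum_eq_add_sum_erase, genSum_eq_add_sum_erase c j, algebraMap_eq_single,
    algebraMap_eq_single]
  simp only [map_sub, map_add, map_sum, mul_sub, mul_add, Finset.mul_sum,
    MonoidAlgebra.single_mul_single, MonoidAlgebra.mapDomainRingHom_apply,
    MonoidAlgebra.mapDomain_single]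
  have h2 : ∀ i ∈ Finset.univ.erase j, MonoidAlgebra.single
      ((twist j : FreeGroup (Fin n) →* FreeGroup (Fin n)) (of i)) (twistCoeff c j l i) =
      MonoidAlgebra.single ((of j)⁻¹ * of i) (-1 * c i) := by
    intro i hi
    rw [h1, twistHom_of_ne (Finset.ne_of_mem_erase hi), twistCoeff,
      if_neg (Finset.ne_of_mem_erase hi), neg_one_mul]
  rw [Finset.sum_congr rfl h2, h1, twistHom_of_self, twistCoeff, if_pos rfl, inv_mul_cancel,
    mul_one, neg_one_mul, neg_one_mul, _root_.map_one, MonoidAlgebra.single_neg,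
    MonoidAlgebra.single_neg]
  abel

theorem twistCoeff_twistCoeff (c : Fin n → ℂ) (j : Fin n) (l : ℂ) :
    twistCoeff (twistCoeff c j l) j (c j) = c := by
  funext i
  by_cases h : i = j <;> simp [twistCoeff, h]

theorem IsReducedEigenstate.comp_twist {c : Fin n → ℂ} {l : ℂ} {φ : FreeGroup (Fin n) → ℂ}
    (h : IsReducedEigenstate (genSum c) l φ) (j : Fin n) :
    IsReducedEigenstate (genSum (twistCoeff c j l)) (c j) fun s => φ (twist j s) :=
  h.comp (twist j) (of j)⁻¹ (mapDomain_twist_genSum c j l)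

theorem existsUnique_isReducedEigenstate_inner {c : Fin n → ℂ} {j : Fin n} {l : ℂ}
    (hj : c j ≠ 0) (hl : ‖l‖ ^ 2 = ‖c j‖ ^ 2 - ∑ i ∈ Finset.univ.erase j, ‖c i‖ ^ 2) :
    ∃! φ : FreeGroup (Fin n) → ℂ, IsReducedEigenstate (genSum c) l φ := by
  have hsum : ‖c j‖ ^ 2 = ∑ i, ‖twistCoeff c j l i‖ ^ 2 := by
    rw [← Finset.add_sum_erase _ _ (Finset.mem_univ j)]
    have h1 : ∑ i ∈ Finset.univ.erase j, ‖twistCoeff c j l i‖ ^ 2 =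
        ∑ i ∈ Finset.univ.erase j, ‖c i‖ ^ 2 :=
      Finset.sum_congr rfl fun i hi => by simp [twistCoeff, Finset.ne_of_mem_erase hi]
    rw [h1, twistCoeff, if_pos rfl, hl]
    ring
  have hne : twistCoeff c j l ≠ 0 := by
    intro h0
    rw [h0] at hsum
    simp [hj] at hsum
  obtain ⟨φ, hφ⟩ := exists_isReducedEigenstate hj hsum
  have hφ' := hφ.comp_twist j
  rw [show twistCoeff c j l j = l by simp [twistCoeff], twistCoeff_twistCoeff] at hφ'
  refine ⟨_, hφ', fun ψ hψ => ?_⟩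
  have h1 := ((hψ.comp_twist j).eq_weightState hne hsum).trans (hφ.eq_weightState hne hsum).symm
  funext s
  rw [← h1]
  exact (congrArg ψ (twistHom_twistHom j s)).symm

end InnerBoundary

/-! ### The eigenstates in closed form -/

theorem prod_map_eq_prod_pow_countP {n : ℕ} (w : Fin n → ℝ) (L : List (Fin n × Bool)) :
    (L.map fun p => w p.1).prod = ∏ i, w i ^ L.countP fun p => p.1 = i := by
  induction L with
  | nil => simp
  | cons a L ih =>
    simp only [List.map_cons, List.prod_cons, ih, List.countP_cons, pow_add,
      Finset.prod_mul_distrib]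
    rw [mul_comm]
    congr 1
    rw [Finset.prod_eq_single a.1 (fun i _ hi => by simp [hi.symm]) (by simp)]
    simp

theorem weightState_ofReal {n : ℕ} (w : Fin n → ℝ) :
    weightState (fun i => (w i : ℂ)) = fun s =>
      if gamma s = 0 then ((∏ i, w i ^ letterCount i s : ℝ) : ℂ) else 0 := by
  funext s
  unfold weightState letterCount
  rw [← prod_map_eq_prod_pow_countP, ← Complex.ofRealHom_eq_coe, map_list_prod, List.map_map]
  simp [Complex.conj_ofReal, Function.comp_def]

theorem isReducedEigenstate_genSum_iff {n : ℕ} {c : Fin n → ℂ} (hc : c ≠ 0) {l : ℂ}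
    (hl : ‖l‖ ^ 2 = ∑ i, ‖c i‖ ^ 2) (ψ : FreeGroup (Fin n) → ℂ) :
    IsReducedEigenstate (genSum c) l ψ ↔ ψ = weightState fun i => conj (c i / l) := by
  refine ⟨fun h => h.eq_weightState hc hl, ?_⟩
  rintro rfl
  obtain ⟨φ, hφ⟩ := exists_isReducedEigenstate (ne_zero_of_norm_sq_eq_sum hc hl) hl
  exact hφ.eq_weightState hc hl ▸ hφ

end ReducedEigenstate

end

theorem theorem5p6 (n : ℕ) (hn : 2 ≤ n) :
    -- nonnegative coefficients, `l = (∑ c_i²)^{1/2}`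
    (∀ c : Fin n → ℝ, (∀ i, 0 ≤ c i) → c ≠ 0 → ∀ l : ℝ, l = Real.sqrt (∑ i, c i ^ 2) →
      ∀ ψ : FreeGroup (Fin n) → ℂ,
        ReducedEigenstate.IsReducedEigenstate
            (ReducedEigenstate.genSum fun i => (c i : ℂ)) (l : ℂ) ψ ↔
          ψ = fun s => if ReducedEigenstate.gamma s = 0 then
              ((∏ i, (c i / l) ^ ReducedEigenstate.letterCount i s : ℝ) : ℂ) else 0) ∧
    -- outer boundary of the spectral annulus, arbitrary complex coefficients
    (∀ c : Fin n → ℂ, c ≠ 0 → ∀ l : ℂ, ‖l‖ ^ 2 = ∑ i, ‖c i‖ ^ 2 →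
      ∀ ψ : FreeGroup (Fin n) → ℂ,
        ReducedEigenstate.IsReducedEigenstate (ReducedEigenstate.genSum c) l ψ ↔
          ψ = ReducedEigenstate.weightState fun i => starRingEnd ℂ (c i / l)) ∧
    -- inner boundary of the spectral annulus, when its radius is positive
    (∀ (c : Fin n → ℂ) (j : Fin n) (l : ℂ),
      ∑ i ∈ Finset.univ.erase j, ‖c i‖ ^ 2 < ‖c j‖ ^ 2 →
      ‖l‖ ^ 2 = ‖c j‖ ^ 2 - ∑ i ∈ Finset.univ.erase j, ‖c i‖ ^ 2 →
      ∃! ψ : FreeGroup (Fin n) → ℂ,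
        ReducedEigenstate.IsReducedEigenstate (ReducedEigenstate.genSum c) l ψ) := by
  refine ⟨fun c _ hc0 l hl ψ => ?_,
    fun c hc l hl ψ => ReducedEigenstate.isReducedEigenstate_genSum_iff hc hl ψ,
    fun c j l hj hl => ReducedEigenstate.existsUnique_isReducedEigenstate_inner ?_ hl⟩
  · have hc' : (fun i => (c i : ℂ)) ≠ 0 := fun h =>
      hc0 (funext fun i => Complex.ofReal_injective (congrFun h i))
    have hl' : ‖(l : ℂ)‖ ^ 2 = ∑ i, ‖(c i : ℂ)‖ ^ 2 := by
      simp only [Complex.norm_real, Real.norm_eq_abs, sq_abs]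
      rw [hl, Real.sq_sqrt (Finset.sum_nonneg fun i _ => sq_nonneg _)]
    rw [ReducedEigenstate.isReducedEigenstate_genSum_iff hc' hl',
      ← ReducedEigenstate.weightState_ofReal fun i => c i / l]
    simp only [← Complex.ofReal_div, Complex.conj_ofReal]
  · rintro h0
    rw [h0, norm_zero, zero_pow two_ne_zero] at hj
    exact absurd hj (not_lt.2 (Finset.sum_nonneg fun i _ => sq_nonneg _))
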